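/- Let $k$ be an algebraically closed field of characteristic $p>0$, and let $n\ge 1$ and $d\ge 1$ be integers such that $p$ divides $d$. Let $\mathrm{Hyp}_d(n)=\operatorname{Proj} k[C_\alpha : \alpha\in\mathbb{N}^{n+1},\ |\alpha|=d]$ be the projective space of hypersurfaces $V(F)\subset\mathbb{P}^n_k$ of degree $d$, where $F=\sum_{|\alpha|=d}C_\alpha X^\alpha$, and let $U_{ns}\subset \mathrm{Hyp}_d(n)$ be the locus of non-singular hypersurfaces, i.e. of those $V(F)$ for which $F,\partial F/\partial X_0,\dots,\partial F/\partial X_n$ have no common zero in $\mathbb{P}^n$ over an algebraically closed field. Then $\mathrm{Hyp}_d(n)\setminus U_{ns}$ is an irreducible divisor, that is, an irreducible closed subset of codimension one, and it is the zero locus of an irreducible homogeneous polynomial $f\in k[C_\alpha]$. Moreover, some multiple of this divisor has an equation that lifts to the discriminant in characteristic zero: the discriminant $\Delta\in\mathbb{Z}[C_\alpha : |\alpha|=d]$ exists, where $\Delta$ is the irreducible polynomial (unique up to sign) which, over algebraically closed fields of characteristic zero, vanishes at exactly those nonzero forms of degree $d$ in $n+1$ variables that define a singular hypersurface; and there are an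 integer $e\ge 1$ and a constant $c\in k^\times$ such that the image of $\Delta$ in $k[C_\alpha]$ is $c f^{e}$. -/

import Mathlib

open MvPolynomial

universe u

attribute [local instance] MvPolynomial.gradedAlgebra

/-- The multi-indices `α = (α₀, …, αₙ)` with `|α| = d`. -/
abbrev DegreeExponent (n d : ℕ) : Type :=
  {α : Fin (n + 1) →₀ ℕ // α ∈ Finset.finsuppAntidiag (Finset.univ : Finset (Fin (n + 1))) d}

/-- The form `∑_{|α| = d} c_α X^α` of degree `d` in `X₀, …, Xₙ` with coefficients `c`. -/
noncomputable def formOfCoeffs {R : Type u} [CommRing R] {n d : ℕ} (c : DegreeExponent n d → R) :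
    MvPolynomial (Fin (n + 1)) R :=
  ∑ α : DegreeExponent n d, monomial α.1 (c α)

/-- The hypersurface `V(F) ⊆ ℙⁿ` over the field `K` is non-singular:
`V(F, ∂F/∂X₀, …, ∂F/∂Xₙ)` has no geometric point. -/
def IsNonsingularHypersurface {K : Type u} [Field K] {n : ℕ}
    (F : MvPolynomial (Fin (n + 1)) K) : Prop :=
  ¬ ∃ x : Fin (n + 1) → AlgebraicClosure K, x ≠ 0 ∧ aeval x F = 0 ∧
    ∀ i, aeval x (pderiv i F) = 0

/-- The projective space `Hyp_d(n) = Proj k[C_α : |α| = d]` of hypersurfaces of degree `d` in `ℙⁿ`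
over `k`, with its Zariski topology. -/
abbrev Hyp (k : Type u) [Field k] (n d : ℕ) : Type u :=
  ProjectiveSpectrum (homogeneousSubmodule (DegreeExponent n d) k)

/-- The equation of the hypersurface parametrised by a point `P` of `Hyp_d(n)`, namely the universal
form `∑ C_α X^α` with coefficients taken in the residue field of the ideal `P` of `k[C_α]`. (This is
an extension of the residue field of `P` as a point of `Proj`; the form is the base change of the
hypersurface over `P` to that extension.) -/
noncomputable def Hyp.equation {k : Type u} [Field k] {n d : ℕ} (P : Hyp k n d) :
    MvPolynomial (Fin (n + 1)) P.asHomogeneousIdeal.toIdeal.ResidueField :=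
  formOfCoeffs fun α : DegreeExponent n d =>
    algebraMap (MvPolynomial (DegreeExponent n d) k) P.asHomogeneousIdeal.toIdeal.ResidueField (X α)

/-- The locus `U_ns ⊆ Hyp_d(n)` of non-singular hypersurfaces. -/
def nonsingularLocus (k : Type u) [Field k] (n d : ℕ) : Set (Hyp k n d) :=
  {P | IsNonsingularHypersurface P.equation}

/-- An irreducible divisor: an irreducible closed subset of codimension one. The codimension is the
supremum of the lengths of chains of irreducible closed subsets that start at `Z`. -/
structure IsIrreducibleDivisor {T : Type u} [TopologicalSpace T] (Z : Set T) : Prop where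
  isIrreducible : IsIrreducible Z
  isClosed : IsClosed Z
  codim_eq_one :
    Order.coheight (⟨Z, isIrreducible, isClosed⟩ : TopologicalSpace.IrreducibleCloseds T) = 1

/-- `f` is a defining equation of the (reduced, irreducible) divisor `Z` in `Hyp_d(n)`: an
irreducible homogeneous polynomial in the coordinates `C_α` whose zero locus is `Z`. -/
structure IsDefiningEquation {k : Type u} [Field k] {n d : ℕ}
    (f : MvPolynomial (DegreeExponent n d) k) (Z : Set (Hyp k n d)) : Prop where
  irreducible : Irreducible f
  isHomogeneous : ∃ m : ℕ, f.IsHomogeneous m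
  zeroLocus_eq :
    ProjectiveSpectrum.zeroLocus (homogeneousSubmodule (DegreeExponent n d) k) {f} = Z

/-- `Δ ∈ ℤ[C_α : |α| = d]` is the discriminant of forms of degree `d` in `n + 1` variables in
characteristic zero (it is unique up to sign): it is irreducible in `ℤ[C_α]`, in particular
primitive, and over algebraically closed fields of characteristic zero it vanishes at precisely the
nonzero forms that define a singular hypersurface. -/
structure IsDiscriminant {n d : ℕ} (Δ : MvPolynomial (DegreeExponent n d) ℤ) : Prop where
  irreducible : Irreducible Δ
  aeval_eq_zero_iff : ∀ (K : Type u) [Field K] [IsAlgClosed K] [CharZero K]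
    (c : DegreeExponent n d → K), c ≠ 0 →
      (aeval c Δ = 0 ↔ ¬ IsNonsingularHypersurface (formOfCoeffs c))

/-! ### Forms and their singular points -/

section Forms

variable {R S T : Type*} [CommRing R] [CommRing S] [CommRing T] {n d : ℕ}

/-! Write the degree as `d + 1` and consider pairs (form, singular point). Where `x i = 1`, Euler's
relation makes the equation of `∂F/∂X_i` redundant, and the remaining `n + 1` equations can be
solved, over any ring, for the coefficients of the monomials `X_i ^ d * X_j`. So each chart of the
incidence variety is an affine space with one coordinate fewer than there are coefficients. The
kernel of the comorphism `incidenceHom` is a nonzero prime ideal, the same for all charts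
(`incidenceHom_eq_zero_iff`): the discriminant ideal, defined over any domain, in particular over
`k` and over `ℤ`. Elimination theory shows that its zeros over a field are exactly the singular
forms (`not_isNonsingularHypersurface_iff`).

The crux is that this ideal is principal, that is, that a generic singular form has only finitely
many singular points in the chart. For this one example suffices: when the characteristic divides `d
+ 1`, the cone `coneForm` is singular at `(1 : 0 : … : 0)` and nowhere on `X_0 = 0`. Elimination
spreads the absence of singular points on that hyperplane to the generic singular form, whose
singular point is therefore algebraic over its coefficients
(`isAlgebraic_adjoin_range_incidenceHom`). Hence all but one of the coefficients are algebraically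
independent, the ideal contains no nonzero polynomial free of the remaining variable, and Gauss's
lemma makes it principal (`MvPolynomial.exists_prime_eq_span_singleton`). Over `ℤ` the same
independence follows by reduction modulo `p`.

The generators `f` over `k` and `Δ` over `ℤ` describe singularity over every field to which they
specialise. So `f` and the reduction of `Δ` lie in the same prime ideals of `k[C_α]`, and since `f`
is prime the reduction is a constant times a power of `f`. -/

theorem DegreeExponent.degree_eq (α : DegreeExponent n d) : α.1.degree = d := by
  have h := α.2
  rw [Finset.mem_finsuppAntidiag] at h
  rw [Finsupp.degree_eq_sum]
  exact h.1

/-- A multi-index of total degree `d`, as an element of `DegreeExponent n d`. -/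
def DegreeExponent.mk (α : Fin (n + 1) →₀ ℕ) (h : α.degree = d) : DegreeExponent n d :=
  ⟨α, by
    rw [Finset.mem_finsuppAntidiag]
    exact ⟨by rw [← h, Finsupp.degree_eq_sum], Finset.subset_univ _⟩⟩

theorem coeff_formOfCoeffs (c : DegreeExponent n d → R) (α : DegreeExponent n d) :
    coeff α.1 (formOfCoeffs c) = c α := by
  classical
  rw [formOfCoeffs, coeff_sum, Finset.sum_eq_single α]
  · simp
  · intro β _ hβ
    rw [coeff_monomial, if_neg fun h => hβ (Subtype.ext h)]
  · simp

theorem formOfCoeffs_isHomogeneous (c : DegreeExponent n d → R) :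
    (formOfCoeffs c).IsHomogeneous d :=
  IsHomogeneous.sum _ _ _ fun α _ => isHomogeneous_monomial _ α.degree_eq

theorem map_formOfCoeffs (f : R →+* S) (c : DegreeExponent n d → R) :
    map f (formOfCoeffs c) = formOfCoeffs (f ∘ c) := by
  simp [formOfCoeffs, map_monomial]

theorem formOfCoeffs_smul (t : R) (c : DegreeExponent n d → R) :
    formOfCoeffs (t • c) = C t * formOfCoeffs c := by
  simp [formOfCoeffs, Finset.mul_sum, C_mul_monomial]

/-- A homogeneous polynomial is the form with the corresponding coefficients. -/
theorem formOfCoeffs_coeff {F : MvPolynomial (Fin (n + 1)) R} (hF : F.IsHomogeneous d) :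
    formOfCoeffs (fun α : DegreeExponent n d => coeff α.1 F) = F := by
  ext m
  by_cases hm : m.degree = d
  · exact coeff_formOfCoeffs _ (DegreeExponent.mk m hm)
  · rw [(formOfCoeffs_isHomogeneous _).coeff_eq_zero hm, hF.coeff_eq_zero hm]

/-- The polynomial `F` and its partial derivatives vanish at `x`. -/
def IsSingularAt (F : MvPolynomial (Fin (n + 1)) T) (x : Fin (n + 1) → T) : Prop :=
  eval x F = 0 ∧ ∀ i, eval x (pderiv i F) = 0

theorem IsSingularAt.map {F : MvPolynomial (Fin (n + 1)) R} {x : Fin (n + 1) → R}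
    (h : IsSingularAt F x) (f : R →+* S) : IsSingularAt (MvPolynomial.map f F) (f ∘ x) := by
  refine ⟨?_, fun i => ?_⟩
  · rw [eval_map, ← eval₂_comp, h.1, map_zero]
  · rw [pderiv_map, eval_map, ← eval₂_comp, h.2, map_zero]

theorem isNonsingularHypersurface_iff {K : Type u} [Field K] (F : MvPolynomial (Fin (n + 1)) K) :
    IsNonsingularHypersurface F ↔ ¬ ∃ x : Fin (n + 1) → AlgebraicClosure K, x ≠ 0 ∧
      IsSingularAt (map (algebraMap K (AlgebraicClosure K)) F) x := by
  simp only [IsNonsingularHypersurface, IsSingularAt, pderiv_map, eval_map, aeval_def]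

/-- The ideal generated by a polynomial and its partial derivatives. -/
noncomputable def singularIdeal (F : MvPolynomial (Fin (n + 1)) T) :
    Ideal (MvPolynomial (Fin (n + 1)) T) :=
  Ideal.span (insert F (Set.range fun i => pderiv i F))

theorem IsSingularAt.eval_eq_zero {F : MvPolynomial (Fin (n + 1)) T} {x : Fin (n + 1) → T}
    (h : IsSingularAt F x) {g : MvPolynomial (Fin (n + 1)) T} (hg : g ∈ singularIdeal F) :
    eval x g = 0 := by
  have : singularIdeal F ≤ RingHom.ker (eval x) := by
    rw [singularIdeal, Ideal.span_le]
    rintro _ (rfl | ⟨i, rfl⟩)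
    exacts [h.1, h.2 i]
  exact this hg

theorem map_mem_singularIdeal (f : R →+* S) {F g : MvPolynomial (Fin (n + 1)) R}
    (hg : g ∈ singularIdeal F) : map f g ∈ singularIdeal (map f F) := by
  have : singularIdeal F ≤ (singularIdeal (map f F)).comap (map f) := by
    rw [singularIdeal, Ideal.span_le]
    rintro _ (rfl | ⟨i, rfl⟩)
    · exact Ideal.subset_span (Set.mem_insert _ _)
    · refine Ideal.subset_span (Set.mem_insert_of_mem _ ⟨i, ?_⟩)
      exact pderiv_map
  exact this hg

/-- Euler's relation `∑ X_j ∂_j F = d F` at `x` leaves only the term `∂_i F`, with coefficient `x i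
= 1`. This works in every characteristic because `F` itself is assumed to vanish. -/
theorem isSingularAt_of_euler {F : MvPolynomial (Fin (n + 1)) T} (hF : F.IsHomogeneous d)
    {x : Fin (n + 1) → T} {i : Fin (n + 1)} (hx : x i = 1) (h0 : eval x F = 0)
    (h : ∀ j, j ≠ i → eval x (pderiv j F) = 0) : IsSingularAt F x := by
  refine ⟨h0, fun j => ?_⟩
  rcases eq_or_ne j i with rfl | hj
  · have := congrArg (eval x) hF.sum_X_mul_pderiv
    rw [map_sum, Finset.sum_eq_single j] at this
    · simpa [hx, h0] using this
    · intro l _ hl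
      simp [h l hl]
    · simp
  · exact h j hj

theorem eval_smul_of_isHomogeneous {F : MvPolynomial (Fin (n + 1)) T} (hF : F.IsHomogeneous d)
    (t : T) (x : Fin (n + 1) → T) : eval (t • x) F = t ^ d * eval x F := by
  rw [eval_eq, eval_eq, Finset.mul_sum]
  refine Finset.sum_congr rfl fun m hm => ?_
  have hd : m.degree = d := by
    by_contra h
    exact mem_support_iff.1 hm (hF.coeff_eq_zero h)
  have : ∏ i ∈ m.support, (t • x) i ^ m i = t ^ d * ∏ i ∈ m.support, x i ^ m i := by
    simp only [Pi.smul_apply, smul_eq_mul, mul_pow, Finset.prod_mul_distrib]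
    rw [Finset.prod_pow_eq_pow_sum, ← hd]
    rfl
  rw [this]
  ring

theorem IsSingularAt.of_smul {F : MvPolynomial (Fin (n + 1)) T} (hF : F.IsHomogeneous d)
    {t : T} (ht : IsUnit t) {x : Fin (n + 1) → T} (h : IsSingularAt F (t • x)) :
    IsSingularAt F x := by
  refine ⟨?_, fun i => ?_⟩
  · have := h.1
    rwa [eval_smul_of_isHomogeneous hF, (ht.pow d).mul_right_eq_zero] at this
  · have := h.2 i
    rwa [eval_smul_of_isHomogeneous hF.pderiv, (ht.pow _).mul_right_eq_zero] at this

end Forms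

/-! ### Forms singular at a point of a standard affine chart

A form of degree `d + 1` which is singular at a point `ξ` with `ξ i = 1` is determined by `ξ` and
its coefficients away from the monomials `X i ^ d * X j`. -/

section Chart

variable {R S T : Type*} [CommRing R] [CommRing S] [CommRing T] {n d : ℕ}

/-- The exponent of the monomial `X i ^ d * X j`. -/
noncomputable def nearExponent (d : ℕ) (i j : Fin (n + 1)) : DegreeExponent n (d + 1) :=
  DegreeExponent.mk (Finsupp.single i d + Finsupp.single j 1) (by simp)

theorem nearExponent_injective (i : Fin (n + 1)) :
    Function.Injective (nearExponent (n := n) d i) := by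
  intro j j' h
  have hval : Finsupp.single i d + Finsupp.single j 1 = Finsupp.single i d + Finsupp.single j' 1 :=
    congrArg Subtype.val h
  exact Finsupp.single_left_injective one_ne_zero (add_left_cancel hval)

/-- The exponents of the monomials other than `X i ^ d * X j`. -/
abbrev FarExponent (n d : ℕ) (i : Fin (n + 1)) : Type :=
  {α : DegreeExponent n (d + 1) // α ∉ Set.range (nearExponent d i)}

open Classical in
/-- The part of a form without the monomials `X i ^ d * X j`. -/
noncomputable def farForm (i : Fin (n + 1)) (h : FarExponent n d i → T) :
    MvPolynomial (Fin (n + 1)) T :=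
  formOfCoeffs (d := d + 1) fun α =>
    if hα : α ∉ Set.range (nearExponent d i) then h ⟨α, hα⟩ else 0

theorem map_farForm (f : R →+* S) (i : Fin (n + 1)) (h : FarExponent n d i → R) :
    map f (farForm i h) = farForm i (f ∘ h) := by
  rw [farForm, map_formOfCoeffs, farForm]
  congr 1
  ext α
  simp only [Function.comp_apply]
  split_ifs <;> simp

theorem formOfCoeffs_eq_farForm_add (i : Fin (n + 1)) (c : DegreeExponent n (d + 1) → T) :
    formOfCoeffs c = farForm i (fun α => c α.1) +
      ∑ j, C (c (nearExponent d i j)) * (X i ^ d * X j) := by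
  classical
  have hX : ∀ j, C (c (nearExponent d i j)) * (X i ^ d * X j) =
      monomial (nearExponent d i j).1 (c (nearExponent d i j)) := by
    intro j
    rw [X_pow_eq_monomial, X, monomial_mul, C_mul_monomial, one_mul, mul_one]
    rfl
  simp_rw [hX]
  rw [farForm, formOfCoeffs, formOfCoeffs,
    ← Finset.sum_filter_add_sum_filter_not _ (fun α => α ∉ Set.range (nearExponent d i))]
  congr 1
  · rw [Finset.sum_filter]
    refine Finset.sum_congr rfl fun α _ => ?_
    split_ifs <;> simp
  · symm
    refine Finset.sum_nbij (nearExponent d i) ?_ ?_ ?_ ?_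
    · intro j _
      simp
    · exact (nearExponent_injective i).injOn
    · intro α hα
      obtain ⟨j, hj⟩ : α ∈ Set.range (nearExponent d i) := by simpa using hα
      exact ⟨j, by simp, hj⟩
    · intro j _
      rfl

variable {i : Fin (n + 1)} {ξ : Fin (n + 1) → T}

theorem eval_formOfCoeffs_of_eq_one (hξ : ξ i = 1) (c : DegreeExponent n (d + 1) → T) :
    eval ξ (formOfCoeffs c) = eval ξ (farForm i fun α => c α.1) +
      ∑ j, c (nearExponent d i j) * ξ j := by
  rw [formOfCoeffs_eq_farForm_add i c]
  simp [hξ]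

theorem eval_pderiv_formOfCoeffs_of_eq_one (hξ : ξ i = 1) (c : DegreeExponent n (d + 1) → T)
    {j : Fin (n + 1)} (hj : j ≠ i) :
    eval ξ (pderiv j (formOfCoeffs c)) = eval ξ (pderiv j (farForm i fun α => c α.1)) +
      c (nearExponent d i j) := by
  rw [formOfCoeffs_eq_farForm_add i c]
  simp only [map_add, map_sum, Derivation.leibniz, Derivation.leibniz_pow, pderiv_C,
    pderiv_X_of_ne hj.symm, smul_eq_mul]
  simp [hξ, pderiv_X, Pi.single_apply, apply_ite (eval ξ)]

open Classical in
/-- The coefficient of `X i ^ d * X j` of the form singular at `ξ` whose other coefficients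
are given by `h`. -/
noncomputable def nearCoeff (i : Fin (n + 1)) (h : FarExponent n d i → T) (ξ : Fin (n + 1) → T)
    (j : Fin (n + 1)) : T :=
  if j = i then
    -eval ξ (farForm i h) + ∑ l ∈ Finset.univ.erase i, eval ξ (pderiv l (farForm i h)) * ξ l
  else -eval ξ (pderiv j (farForm i h))

open Classical in
/-- The coefficients of the form singular at `ξ` whose coefficients away from the monomials
`X i ^ d * X j` are given by `h`. -/
noncomputable def chartCoeffs (i : Fin (n + 1)) (h : FarExponent n d i → T)
    (ξ : Fin (n + 1) → T) (α : DegreeExponent n (d + 1)) : T :=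
  if hα : α ∈ Set.range (nearExponent d i) then nearCoeff i h ξ hα.choose else h ⟨α, hα⟩

theorem chartCoeffs_nearExponent (h : FarExponent n d i → T) (j : Fin (n + 1)) :
    chartCoeffs i h ξ (nearExponent d i j) = nearCoeff i h ξ j := by
  have hα : nearExponent d i j ∈ Set.range (nearExponent d i) := ⟨j, rfl⟩
  rw [chartCoeffs, dif_pos hα, nearExponent_injective i hα.choose_spec]

theorem chartCoeffs_farExponent (h : FarExponent n d i → T) (α : FarExponent n d i) :
    chartCoeffs i h ξ α.1 = h α := by
  rw [chartCoeffs, dif_neg α.2]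

/-- The solved coefficients are integral polynomial expressions in the point and the free
coefficients; this naturality turns the generic solution into a universal one. -/
theorem comp_chartCoeffs (f : T →+* S) (h : FarExponent n d i → T) :
    f ∘ chartCoeffs i h ξ = chartCoeffs i (f ∘ h) (f ∘ ξ) := by
  have h1 : ∀ F : MvPolynomial (Fin (n + 1)) T, f (eval ξ F) = eval (f ∘ ξ) (map f F) := by
    intro F
    rw [eval_map, ← eval₂_comp]
  ext α
  rw [Function.comp_apply]
  by_cases hα : α ∈ Set.range (nearExponent d i)
  · obtain ⟨j, rfl⟩ := hα
    rw [chartCoeffs_nearExponent, chartCoeffs_nearExponent, nearCoeff, nearCoeff]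
    split_ifs with hj
    · simp only [map_add, map_neg, map_sum, map_mul, h1, ← pderiv_map, map_farForm,
        Function.comp_apply]
    · simp only [map_neg, h1, ← pderiv_map, map_farForm]
  · rw [chartCoeffs_farExponent h ⟨α, hα⟩, chartCoeffs_farExponent _ ⟨α, hα⟩, Function.comp_apply]

/-- The singularity conditions are a triangular linear system with unit pivots. For `j ≠ i`, the
derivative `∂_j` at `ξ` sees only the coefficient of `X_i ^ d * X_j` among the near ones; the
vanishing of the form then fixes the coefficient of `X_i ^ (d + 1)`. -/
theorem isSingularAt_formOfCoeffs_iff (hξ : ξ i = 1) (c : DegreeExponent n (d + 1) → T) :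
    IsSingularAt (formOfCoeffs c) ξ ↔ c = chartCoeffs i (fun α => c α.1) ξ := by
  classical
  have key : (∀ j, c (nearExponent d i j) = nearCoeff i (fun α => c α.1) ξ j) ↔
      c = chartCoeffs i (fun α => c α.1) ξ := by
    constructor
    · intro h
      ext α
      by_cases hα : α ∈ Set.range (nearExponent d i)
      · obtain ⟨j, rfl⟩ := hα
        rw [chartCoeffs_nearExponent, h j]
      · rw [chartCoeffs_farExponent _ ⟨α, hα⟩]
    · intro h j
      conv_lhs => rw [h]
      rw [chartCoeffs_nearExponent]
  rw [← key]
  have hsum : ∑ j, c (nearExponent d i j) * ξ j = c (nearExponent d i i) +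
      ∑ j ∈ Finset.univ.erase i, c (nearExponent d i j) * ξ j := by
    rw [← Finset.add_sum_erase _ _ (Finset.mem_univ i), hξ, mul_one]
  constructor
  · intro h
    have hne : ∀ j, j ≠ i →
        c (nearExponent d i j) = -eval ξ (pderiv j (farForm i fun α => c α.1)) := by
      intro j hj
      have := h.2 j
      rw [eval_pderiv_formOfCoeffs_of_eq_one hξ c hj] at this
      linear_combination this
    intro j
    rw [nearCoeff]
    split_ifs with hj
    · subst hj
      have h0 := h.1
      rw [eval_formOfCoeffs_of_eq_one hξ, hsum, Finset.sum_congr rfl (fun l hl => by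
        rw [hne l (Finset.ne_of_mem_erase hl), neg_mul]), Finset.sum_neg_distrib] at h0
      linear_combination h0
    · exact hne j hj
  · intro h
    have hne : ∀ j, j ≠ i →
        c (nearExponent d i j) = -eval ξ (pderiv j (farForm i fun α => c α.1)) := by
      intro j hj
      rw [h j, nearCoeff, if_neg hj]
    refine isSingularAt_of_euler (formOfCoeffs_isHomogeneous c) hξ ?_ fun j hj => ?_
    · rw [eval_formOfCoeffs_of_eq_one hξ, hsum, Finset.sum_congr rfl (fun l hl => by
        rw [hne l (Finset.ne_of_mem_erase hl), neg_mul]), Finset.sum_neg_distrib, h i, nearCoeff,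
        if_pos rfl]
      ring
    · rw [eval_pderiv_formOfCoeffs_of_eq_one hξ c hj, hne j hj, add_neg_cancel]

theorem isSingularAt_chartCoeffs (hξ : ξ i = 1) (h : FarExponent n d i → T) :
    IsSingularAt (formOfCoeffs (chartCoeffs i h ξ)) ξ := by
  rw [isSingularAt_formOfCoeffs_iff hξ]
  congr 1
  ext α
  rw [chartCoeffs_farExponent]

/-! ### The generic singular form in a chart -/

/-- The coordinates of the `i`-th chart of the incidence variety of pairs of a form and a
singular point of it. -/
abbrev ChartIndex (n d : ℕ) (i : Fin (n + 1)) : Type :=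
  {j : Fin (n + 1) // j ≠ i} ⊕ FarExponent n d i

theorem card_chartIndex_add_one (i : Fin (n + 1)) :
    Nat.card (ChartIndex n d i) + 1 = Nat.card (DegreeExponent n (d + 1)) := by
  classical
  have h1 : Nat.card (Set.range (nearExponent (n := n) d i)) = n + 1 := by
    rw [Nat.card_range_of_injective (nearExponent_injective i)]
    simp
  have h2 : Nat.card {j : Fin (n + 1) // j ≠ i} = n := by simp
  have h3 := Nat.card_congr (Equiv.sumCompl fun α => α ∈ Set.range (nearExponent (n := n) d i))
  rw [Nat.card_sum] at h3
  rw [Nat.card_sum, h2, ← h3]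
  change n + _ + 1 = Nat.card (Set.range (nearExponent (n := n) d i)) + _
  rw [h1]
  change n + Nat.card {α // ¬ _} + 1 = _
  ring

variable (R) in
open Classical in
/-- The generic point of the `i`-th standard affine chart. -/
noncomputable def chartPoint (d : ℕ) (i : Fin (n + 1)) (j : Fin (n + 1)) :
    MvPolynomial (ChartIndex n d i) R :=
  if hj : j = i then 1 else X (Sum.inl ⟨j, hj⟩)

theorem chartPoint_self (i : Fin (n + 1)) : chartPoint R d i i = 1 := by
  simp [chartPoint]

theorem chartPoint_ne_zero [Nontrivial R] (i j : Fin (n + 1)) : chartPoint R d i j ≠ 0 := by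
  rw [chartPoint]
  split_ifs
  · exact one_ne_zero
  · exact X_ne_zero _

variable (R) in
/-- The coefficients of the generic form singular at the generic point of the `i`-th chart. -/
noncomputable def genericCoeffs (d : ℕ) (i : Fin (n + 1)) (α : DegreeExponent n (d + 1)) :
    MvPolynomial (ChartIndex n d i) R :=
  chartCoeffs i (fun β => X (Sum.inr β)) (chartPoint R d i) α

theorem isSingularAt_genericCoeffs (i : Fin (n + 1)) :
    IsSingularAt (formOfCoeffs (genericCoeffs R d i)) (chartPoint R d i) :=
  isSingularAt_chartCoeffs (chartPoint_self i) _

/-- Every form singular at a point of the `i`-th chart is a specialisation of the generic one. -/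
theorem exists_aeval_genericCoeffs [Algebra R T] (hξ : ξ i = 1)
    {c : DegreeExponent n (d + 1) → T} (hc : IsSingularAt (formOfCoeffs c) ξ) :
    ∃ ψ : MvPolynomial (ChartIndex n d i) R →ₐ[R] T,
      ψ ∘ genericCoeffs R d i = c ∧ ψ ∘ chartPoint R d i = ξ := by
  have hpt : aeval (Sum.elim (fun j : {j // j ≠ i} => ξ j.1) (fun β : FarExponent n d i => c β.1)) ∘
      chartPoint R d i = ξ := by
    ext j
    rw [Function.comp_apply, chartPoint]
    split_ifs with hj
    · rw [map_one, hj, hξ]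
    · simp
  refine ⟨aeval (Sum.elim (fun j => ξ j.1) (fun β => c β.1)), ?_, hpt⟩
  rw [(isSingularAt_formOfCoeffs_iff hξ c).1 hc]
  have := comp_chartCoeffs (i := i) (ξ := chartPoint R d i)
    (aeval (R := R) (Sum.elim (fun j : {j // j ≠ i} => ξ j.1)
      (fun β : FarExponent n d i => c β.1))).toRingHom (fun β => X (Sum.inr β))
  refine Eq.trans ?_ (this.trans ?_)
  · simp only [chartCoeffs_farExponent]
    rfl
  · congr 1
    ext β
    simp

end Chart

/-! ### Elimination -/

section Elimination

variable {A L : Type*} [CommRing A] [Field L] {n : ℕ}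

theorem monomial_mem_of_forall_X_pow_mem {J : Ideal (MvPolynomial (Fin (n + 1)) A)}
    {N : Fin (n + 1) → ℕ} (hN : ∀ i, X i ^ N i ∈ J) {β : Fin (n + 1) →₀ ℕ}
    (hβ : ∑ i, N i < β.degree) : monomial β 1 ∈ J := by
  obtain ⟨i, hi⟩ : ∃ i, N i ≤ β i := by
    by_contra! h
    rw [Finsupp.degree_eq_sum] at hβ
    exact absurd (Finset.sum_le_sum fun i (_ : i ∈ Finset.univ) => (h i).le) (not_le.2 hβ)
  have : monomial β (1 : A) = X i ^ N i * monomial (β - Finsupp.single i (N i)) 1 := by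
    rw [X_pow_eq_monomial, monomial_mul, one_mul, add_tsub_cancel_of_le]
    simpa using hi
  rw [this]
  exact J.mul_mem_right _ (hN i)

theorem homogeneousComponent_mem_span {G : Set (MvPolynomial (Fin (n + 1)) A)}
    (hG : ∀ g ∈ G, ∃ m, g.IsHomogeneous m) {h : MvPolynomial (Fin (n + 1)) A}
    (hh : h ∈ Ideal.span G) (m : ℕ) : homogeneousComponent m h ∈ Ideal.span G := by
  refine homogeneousComponent_mem_of_mem (Ideal.homogeneous_span _ G fun g hg => ?_) hh m
  obtain ⟨m, hm⟩ := hG g hg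
  exact ⟨m, hm⟩

/-- The Nullstellensatz over the fraction field of `A / ker c` puts all monomials of large degree
into the extended ideal; the elements `a` are the cleared denominators. -/
theorem exists_monomial_mem_span_map [IsAlgClosed L] (c : A →+* L)
    (G : Set (MvPolynomial (Fin (n + 1)) A))
    (hzero : ∀ x : Fin (n + 1) → L, (∀ g ∈ G, eval₂ c x g = 0) → x = 0) :
    ∃ M : ℕ, ∀ β : Fin (n + 1) →₀ ℕ, β.degree = M → ∃ a : A, c a ≠ 0 ∧ ∃ h ∈ Ideal.span G,
      map (Ideal.Quotient.mk (RingHom.ker c)) h =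
        monomial β (Ideal.Quotient.mk (RingHom.ker c) a) := by
  set P := RingHom.ker c
  have hPp : P.IsPrime := RingHom.ker_isPrime c
  let q := Ideal.Quotient.mk P
  let κ := FractionRing (A ⧸ P)
  let ι : A ⧸ P →+* L := RingHom.kerLift c
  have hι : Function.Injective ι := RingHom.kerLift_injective c
  let ικ : κ →+* L := IsFractionRing.lift hι
  let : Algebra κ L := ικ.toAlgebra
  have hcomp : (algebraMap κ L).comp ((algebraMap (A ⧸ P) κ).comp q) = c := by
    ext a
    change ικ (algebraMap (A ⧸ P) κ (q a)) = c a
    rw [IsFractionRing.lift_algebraMap]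
    rfl
  let JD : Ideal (MvPolynomial (Fin (n + 1)) (A ⧸ P)) := (Ideal.span G).map (map q)
  let Jκ : Ideal (MvPolynomial (Fin (n + 1)) κ) := JD.map (map (algebraMap (A ⧸ P) κ))
  have hX : ∀ i, ∃ N, (X i : MvPolynomial (Fin (n + 1)) κ) ^ N ∈ Jκ := by
    intro i
    suffices h : X i ∈ Jκ.radical from h
    -- The Nullstellensatz for polynomials over `κ`, with points taken in the algebraically closed
    -- extension `L`.
    rw [← vanishingIdeal_zeroLocus_eq_radical (K := L)]
    intro x hx
    suffices h : x = 0 by simp [h]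
    refine hzero x fun g hg => ?_
    have := hx (map (algebraMap (A ⧸ P) κ) (map q g))
      (Ideal.mem_map_of_mem _ (Ideal.mem_map_of_mem _ (Ideal.subset_span hg)))
    rw [aeval_def, eval₂_map, eval₂_map, RingHom.comp_assoc, hcomp] at this
    exact this
  choose N hN using hX
  refine ⟨∑ i, N i + 1, fun β hβ => ?_⟩
  have hmem : monomial β 1 ∈ Jκ := monomial_mem_of_forall_X_pow_mem hN (by omega)
  let : Algebra (MvPolynomial (Fin (n + 1)) (A ⧸ P)) (MvPolynomial (Fin (n + 1)) κ) :=
    (map (algebraMap (A ⧸ P) κ)).toAlgebra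
  have : IsLocalization ((nonZeroDivisors (A ⧸ P)).map (C (σ := Fin (n + 1))))
      (MvPolynomial (Fin (n + 1)) κ) := MvPolynomial.isLocalization _ _
  obtain ⟨⟨⟨b, hb⟩, ⟨_, s, hs, rfl⟩⟩, hbs⟩ := (IsLocalization.mem_map_algebraMap_iff
    ((nonZeroDivisors (A ⧸ P)).map (C (σ := Fin (n + 1)))) (MvPolynomial (Fin (n + 1)) κ)).1 hmem
  obtain ⟨a, rfl⟩ := Ideal.Quotient.mk_surjective s
  obtain ⟨h, hh, rfl⟩ := (Ideal.mem_map_iff_of_surjective (map q)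
    (map_surjective _ Ideal.Quotient.mk_surjective)).1 hb
  refine ⟨a, fun ha => nonZeroDivisors.ne_zero hs (Ideal.Quotient.eq_zero_iff_mem.2 ha), h, hh, ?_⟩
  apply map_injective _ (IsFractionRing.injective (A ⧸ P) κ)
  refine hbs.symm.trans ?_
  change monomial β 1 * map (algebraMap (A ⧸ P) κ) (C (q a)) = _
  rw [map_C, mul_comm, C_mul_monomial, mul_one, map_monomial]

/-- The main theorem of elimination theory: if a system of homogeneous equations over `A` has no
nontrivial solution at a geometric point `c` of `Spec A`, then this holds on a neighbourhood
of `c`, in the strong sense that the equations generate all monomials of some degree. -/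
theorem exists_C_mul_monomial_mem_span [IsAlgClosed L] (c : A →+* L)
    (G : Set (MvPolynomial (Fin (n + 1)) A)) (hG : ∀ g ∈ G, ∃ m, g.IsHomogeneous m)
    (hzero : ∀ x : Fin (n + 1) → L, (∀ g ∈ G, eval₂ c x g = 0) → x = 0) :
    ∃ (M : ℕ) (g : A), c g ≠ 0 ∧ ∀ β : Fin (n + 1) →₀ ℕ, β.degree = M →
      C g * monomial β 1 ∈ Ideal.span G := by
  classical
  obtain ⟨M, hM⟩ := exists_monomial_mem_span_map c G hzero
  choose a ha h hh hah using fun β : DegreeExponent n M => hM β.1 β.degree_eq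
  -- Row `β` holds the degree `M` coefficients of `h β`. Modulo `ker c` the matrix is diagonal with
  -- entries `a β`, so `c` does not kill its determinant, and Cramer's rule expresses `det Q` times
  -- each monomial through the rows.
  let Q : Matrix (DegreeExponent n M) (DegreeExponent n M) A :=
    Matrix.of fun β γ => coeff γ.1 (h β)
  have hQa : ∀ β γ, Q β γ = coeff γ.1 (h β) := fun _ _ => rfl
  have hQ : ∀ β, ∑ γ, C (Q β γ) * monomial γ.1 1 ∈ Ideal.span G := by
    intro β
    have h1 := homogeneousComponent_mem_span hG (hh β) M
    rw [← formOfCoeffs_coeff (homogeneousComponent_isHomogeneous M (h β))] at h1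
    convert! h1 using 1
    refine Finset.sum_congr rfl fun γ _ => ?_
    rw [C_mul_monomial, mul_one]
    beta_reduce
    rw [coeff_homogeneousComponent, if_pos γ.degree_eq, hQa]
  have hcQ : c.mapMatrix Q = Matrix.diagonal fun β => c (a β) := by
    ext β γ
    have h1 := congrArg (coeff γ.1) (hah β)
    rw [coeff_map, coeff_monomial] at h1
    have h2 := congrArg (RingHom.kerLift c) h1
    rw [apply_ite (RingHom.kerLift c), map_zero, RingHom.kerLift_mk, RingHom.kerLift_mk] at h2
    rw [RingHom.mapMatrix_apply, Matrix.map_apply, Matrix.diagonal_apply, hQa, h2]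
    simp only [Subtype.ext_iff]
  refine ⟨M, Q.det, ?_, fun β hβ => ?_⟩
  · rw [RingHom.map_det, hcQ, Matrix.det_diagonal]
    exact Finset.prod_ne_zero_iff.2 fun β _ => ha β
  · have hadj := Matrix.adjugate_mul Q
    let β' := DegreeExponent.mk β hβ
    have : C Q.det * monomial β 1 =
        ∑ γ, C (Q.adjugate β' γ) * ∑ δ, C (Q γ δ) * monomial δ.1 (1 : A) := by
      simp_rw [Finset.mul_sum]
      rw [Finset.sum_comm]
      have h1 : ∀ δ, ∑ γ, C (Q.adjugate β' γ) * (C (Q γ δ) * monomial δ.1 (1 : A)) =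
          C ((Q.adjugate * Q) β' δ) * monomial δ.1 1 := by
        intro δ
        rw [Matrix.mul_apply, map_sum, Finset.sum_mul]
        simp only [map_mul, mul_assoc]
      simp_rw [h1, hadj]
      rw [Finset.sum_eq_single β']
      · simp [β', DegreeExponent.mk]
      · intro δ _ hδ
        simp [Matrix.one_apply_ne hδ.symm]
      · simp
    rw [this]
    exact Ideal.sum_mem _ fun γ _ => Ideal.mul_mem_left _ _ (hQ γ)

end Elimination

/-! ### The ideal of the locus of singular forms -/

section DiscriminantIdeal

variable {R T : Type*} [CommRing R] [CommRing T] {n d : ℕ}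

variable (R n d) in
/-- The universal form `∑ C_α X^α` of degree `d`. -/
noncomputable def universalForm :
    MvPolynomial (Fin (n + 1)) (MvPolynomial (DegreeExponent n d) R) :=
  formOfCoeffs X

theorem map_universalForm (c : MvPolynomial (DegreeExponent n d) R →+* T) :
    map c (universalForm R n d) = formOfCoeffs fun α => c (X α) :=
  map_formOfCoeffs c X

/-- If `X i ^ M * g` lies in the ideal of the universal singular locus, then `g` vanishes on the
forms with a singular point in the `i`-th chart. -/
theorem pow_mul_eq_zero_of_mem_singularIdeal {g : MvPolynomial (DegreeExponent n d) R}
    {i : Fin (n + 1)} {M : ℕ} (hg : X i ^ M * C g ∈ singularIdeal (universalForm R n d))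
    (c : MvPolynomial (DegreeExponent n d) R →+* T) {x : Fin (n + 1) → T}
    (hx : IsSingularAt (formOfCoeffs fun α => c (X α)) x) : x i ^ M * c g = 0 := by
  have h := map_mem_singularIdeal c hg
  rw [map_universalForm] at h
  simpa using hx.eval_eq_zero h

variable (R) in
/-- The morphism from the `i`-th chart of the incidence variety to the space of forms. -/
noncomputable def incidenceHom (d : ℕ) (i : Fin (n + 1)) :
    MvPolynomial (DegreeExponent n (d + 1)) R →ₐ[R] MvPolynomial (ChartIndex n d i) R :=
  aeval (genericCoeffs R d i)

theorem incidenceHom_X (i : Fin (n + 1)) (α : DegreeExponent n (d + 1)) :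
    incidenceHom R d i (X α) = genericCoeffs R d i α := by
  simp [incidenceHom]

theorem isSingularAt_incidenceHom (i : Fin (n + 1)) :
    IsSingularAt (formOfCoeffs fun α => incidenceHom R d i (X α))
      (chartPoint R d i) := by
  simp only [incidenceHom_X]
  exact isSingularAt_genericCoeffs i

theorem incidenceHom_eq_zero_of_mem_singularIdeal {g : MvPolynomial (DegreeExponent n (d + 1)) R}
    {i : Fin (n + 1)} {M : ℕ} (hg : X i ^ M * C g ∈ singularIdeal (universalForm R n (d + 1))) :
    incidenceHom R d i g = 0 := by
  have h := pow_mul_eq_zero_of_mem_singularIdeal hg (incidenceHom R d i).toRingHom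
    (isSingularAt_incidenceHom i)
  rwa [chartPoint_self, one_pow, one_mul] at h

/-- The universal property of the chart: a singular form together with a normalised singular point
over any `R`-algebra is a point of the chart. -/
theorem exists_algHom_comp_incidenceHom [Algebra R T] {i : Fin (n + 1)} {ξ : Fin (n + 1) → T}
    (hξ : ξ i = 1) (c : MvPolynomial (DegreeExponent n (d + 1)) R →ₐ[R] T)
    (hc : IsSingularAt (formOfCoeffs fun α => c (X α)) ξ) :
    ∃ ψ : MvPolynomial (ChartIndex n d i) R →ₐ[R] T,
      ψ.comp (incidenceHom R d i) = c ∧ ψ ∘ chartPoint R d i = ξ := by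
  obtain ⟨ψ, hψ, hψ'⟩ := exists_aeval_genericCoeffs (R := R) hξ hc
  refine ⟨ψ, ?_, hψ'⟩
  ext α
  rw [AlgHom.comp_apply, incidenceHom_X]
  exact congrFun hψ α

/-- Modulo the singular ideal, the universal form is tautologically singular at `(X_0, …, X_n)`.
After inverting `X_i` this point can be normalised, so the universal property of the chart shows
that `g` becomes zero there; a power of `X_i` accounts for the localisation. -/
theorem exists_pow_mul_mem_singularIdeal {g : MvPolynomial (DegreeExponent n (d + 1)) R}
    {i : Fin (n + 1)} (hg : incidenceHom R d i g = 0) :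
    ∃ M : ℕ, X i ^ M * C g ∈ singularIdeal (universalForm R n (d + 1)) := by
  let J := singularIdeal (universalForm R n (d + 1))
  let Q := MvPolynomial (Fin (n + 1)) (MvPolynomial (DegreeExponent n (d + 1)) R) ⧸ J
  let t : Q := Ideal.Quotient.mk J (X i)
  let T := Localization.Away t
  let u : T := algebraMap Q T t
  have hu : IsUnit u := IsLocalization.Away.algebraMap_isUnit t
  let qT : MvPolynomial (Fin (n + 1)) (MvPolynomial (DegreeExponent n (d + 1)) R) →ₐ[R] T :=
    (IsScalarTower.toAlgHom R Q T).comp (Ideal.Quotient.mkₐ R J)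
  let c : MvPolynomial (DegreeExponent n (d + 1)) R →ₐ[R] T :=
    qT.comp (IsScalarTower.toAlgHom R _ _)
  have hcC : ∀ a, c a = qT (C a) := fun a => rfl
  have hqT : ∀ F : MvPolynomial (Fin (n + 1)) (MvPolynomial (DegreeExponent n (d + 1)) R),
      eval (fun j => qT (X j)) (map c.toRingHom F) = qT F := by
    intro F
    rw [eval_map]
    induction F using MvPolynomial.induction_on with
    | C a => rw [eval₂_C]; exact hcC a
    | add p q hp hq => rw [eval₂_add, hp, hq, map_add]
    | mul_X p j hp => rw [eval₂_mul, hp, eval₂_X, map_mul]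
  have hJ : ∀ F ∈ J, qT F = 0 := by
    intro F hF
    change algebraMap Q T (Ideal.Quotient.mk J F) = 0
    rw [Ideal.Quotient.eq_zero_iff_mem.2 hF, map_zero]
  have hsing : IsSingularAt (formOfCoeffs fun α => c (X α)) (fun j => qT (X j)) := by
    change IsSingularAt (formOfCoeffs fun α => c.toRingHom (X α)) _
    rw [← map_universalForm]
    refine ⟨?_, fun j => ?_⟩
    · rw [hqT]
      exact hJ _ (Ideal.subset_span (Set.mem_insert _ _))
    · rw [pderiv_map, hqT]
      exact hJ _ (Ideal.subset_span (Set.mem_insert_of_mem _ ⟨j, rfl⟩))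
  obtain ⟨v, hv⟩ := hu.exists_right_inv
  have hui : qT (X i) = u := rfl
  -- Divide the point by its `i`-th coordinate `u`, which is a unit in `T`, so that it lies in the
  -- `i`-th chart.
  have hscale : (fun j => qT (X j)) = u • (v • fun j => qT (X j)) := by
    rw [smul_smul, hv, one_smul]
  rw [hscale] at hsing
  have hsing' := IsSingularAt.of_smul (formOfCoeffs_isHomogeneous _) hu hsing
  obtain ⟨ψ, hψ, -⟩ := exists_algHom_comp_incidenceHom (i := i)
    (by rw [Pi.smul_apply, hui, smul_eq_mul, mul_comm, hv]) c hsing'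
  have hcg : algebraMap Q T (Ideal.Quotient.mk J (C g)) = 0 := by
    change c g = 0
    rw [← hψ, AlgHom.comp_apply, hg, map_zero]
  obtain ⟨⟨_, M, rfl⟩, hM⟩ := (IsLocalization.map_eq_zero_iff (Submonoid.powers t) T _).1 hcg
  refine ⟨M, Ideal.Quotient.eq_zero_iff_mem.1 ?_⟩
  rw [map_mul, map_pow]
  exact hM

/-- The kernels of the homomorphisms to all charts agree. -/
theorem incidenceHom_eq_zero_iff [IsDomain R] (i j : Fin (n + 1))
    (g : MvPolynomial (DegreeExponent n (d + 1)) R) :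
    incidenceHom R d i g = 0 ↔ incidenceHom R d j g = 0 := by
  suffices h : ∀ i j : Fin (n + 1), incidenceHom R d i g = 0 → incidenceHom R d j g = 0 from
    ⟨h i j, h j i⟩
  intro i j hg
  obtain ⟨M, hM⟩ := exists_pow_mul_mem_singularIdeal hg
  have h := pow_mul_eq_zero_of_mem_singularIdeal hM (incidenceHom R d j).toRingHom
    (isSingularAt_incidenceHom j)
  exact (mul_eq_zero.1 h).resolve_left (pow_ne_zero _ (chartPoint_ne_zero j i))

variable (R n d) in
/-- The ideal of polynomials in the coefficients which vanish on all singular forms of degree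
`d + 1`. -/
noncomputable def discriminantIdeal : Ideal (MvPolynomial (DegreeExponent n (d + 1)) R) :=
  RingHom.ker (incidenceHom R d (0 : Fin (n + 1)))

instance [IsDomain R] : (discriminantIdeal R n d).IsPrime := RingHom.ker_isPrime _

theorem exists_pow_mul_mem_of_mem_discriminantIdeal [IsDomain R]
    {g : MvPolynomial (DegreeExponent n (d + 1)) R} (hg : g ∈ discriminantIdeal R n d)
    (i : Fin (n + 1)) : ∃ M : ℕ, X i ^ M * C g ∈ singularIdeal (universalForm R n (d + 1)) :=
  exists_pow_mul_mem_singularIdeal ((incidenceHom_eq_zero_iff 0 i g).1 hg)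

/-- A form over an algebraically closed field is singular if and only if it is a zero of the
discriminant ideal. -/
theorem exists_isSingularAt_iff [IsDomain R] {L : Type*} [Field L] [IsAlgClosed L]
    (c : MvPolynomial (DegreeExponent n (d + 1)) R →+* L) :
    (∃ x : Fin (n + 1) → L, x ≠ 0 ∧ IsSingularAt (formOfCoeffs fun α => c (X α)) x) ↔
      ∀ g ∈ discriminantIdeal R n d, c g = 0 := by
  constructor
  · rintro ⟨x, hx0, hx⟩ g hg
    obtain ⟨i, hi⟩ := Function.ne_iff.1 hx0
    obtain ⟨M, hM⟩ := exists_pow_mul_mem_of_mem_discriminantIdeal hg i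
    have h := pow_mul_eq_zero_of_mem_singularIdeal hM c hx
    exact (mul_eq_zero.1 h).resolve_left (pow_ne_zero _ hi)
  · intro h
    by_contra! hns
    have hhom : ∀ g ∈ insert (universalForm R n (d + 1))
        (Set.range fun i => pderiv i (universalForm R n (d + 1))), ∃ m, g.IsHomogeneous m := by
      rintro _ (rfl | ⟨i, rfl⟩)
      · exact ⟨_, formOfCoeffs_isHomogeneous _⟩
      · exact ⟨_, (formOfCoeffs_isHomogeneous _).pderiv⟩
    obtain ⟨M, g, hg, hgM⟩ := exists_C_mul_monomial_mem_span c _ hhom fun x hx => by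
      by_contra hx0
      refine hns x hx0 ?_
      rw [← map_universalForm]
      refine ⟨?_, fun i => ?_⟩
      · rw [eval_map]
        exact hx _ (Set.mem_insert _ _)
      · rw [pderiv_map, eval_map]
        exact hx _ (Set.mem_insert_of_mem _ ⟨i, rfl⟩)
    refine hg (h g (incidenceHom_eq_zero_of_mem_singularIdeal (M := M) ?_))
    -- The monomial `X_0 ^ M` is enough, because the discriminant ideal is defined through the chart
    -- `0`.
    have := hgM (Finsupp.single 0 M) (by simp)
    rwa [← X_pow_eq_monomial, mul_comm] at this

/-- Both sides are insensitive to passing to the algebraic closure of `K`. Since `R` may be `ℤ` and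
`K` of any characteristic, this criterion also links the discriminants over `ℤ` and over `k`. -/
theorem not_isNonsingularHypersurface_iff [IsDomain R] {K : Type u} [Field K]
    (c : MvPolynomial (DegreeExponent n (d + 1)) R →+* K) :
    ¬ IsNonsingularHypersurface (formOfCoeffs fun α => c (X α)) ↔
      discriminantIdeal R n d ≤ RingHom.ker c := by
  rw [isNonsingularHypersurface_iff, not_not, map_formOfCoeffs]
  refine (exists_isSingularAt_iff ((algebraMap K (AlgebraicClosure K)).comp c)).trans ?_
  simp only [RingHom.comp_apply, map_eq_zero]
  rfl

end DiscriminantIdeal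

/-! ### A form with an isolated singular point, in characteristic dividing the degree -/

section ConeForm

variable {R : Type*} [CommRing R] {m d : ℕ}

variable (R) in
/-- The variable `X_{l + 1}` for `l ≤ m`, and zero for `l > m`. -/
noncomputable def shiftedVar (m l : ℕ) : MvPolynomial (Fin (m + 1 + 1)) R :=
  if h : l < m + 1 then X (Fin.succ ⟨l, h⟩) else 0

variable (R) in
/-- The cone `X₁ ^ (d + 1) + ∑ Xᵢ * Xᵢ₊₁ ^ d`, which does not involve `X₀`. -/
noncomputable def coneForm (m d : ℕ) : MvPolynomial (Fin (m + 1 + 1)) R :=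
  shiftedVar R m 0 ^ (d + 1) +
    ∑ l ∈ Finset.range (m + 1), shiftedVar R m l * shiftedVar R m (l + 1) ^ d

theorem shiftedVar_isHomogeneous (l : ℕ) : (shiftedVar R m l).IsHomogeneous 1 := by
  rw [shiftedVar]
  split_ifs
  · exact isHomogeneous_X _ _
  · exact isHomogeneous_zero _ _ _

theorem coneForm_isHomogeneous : (coneForm R m d).IsHomogeneous (d + 1) := by
  refine IsHomogeneous.add ?_ (IsHomogeneous.sum _ _ _ fun l _ => ?_)
  · simpa using (shiftedVar_isHomogeneous (R := R) (m := m) 0).pow (d + 1)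
  · simpa [add_comm] using (shiftedVar_isHomogeneous (R := R) (m := m) l).mul
      ((shiftedVar_isHomogeneous (R := R) (m := m) (l + 1)).pow d)

theorem pderiv_zero_shiftedVar (l : ℕ) : pderiv 0 (shiftedVar R m l) = 0 := by
  rw [shiftedVar]
  split_ifs
  · exact pderiv_X_of_ne (Fin.succ_ne_zero _)
  · exact map_zero _

theorem pderiv_succ_shiftedVar {j : ℕ} (hj : j < m + 1) (l : ℕ) :
    pderiv (Fin.succ ⟨j, hj⟩) (shiftedVar R m l) = if l = j then 1 else 0 := by
  rw [shiftedVar]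
  split_ifs with h h' h'
  · subst h'
    exact pderiv_X_self _
  · refine pderiv_X_of_ne fun h1 => h' ?_
    simpa using h1
  · omega
  · exact map_zero _

theorem pderiv_zero_coneForm : pderiv 0 (coneForm R m d) = 0 := by
  simp [coneForm, Derivation.leibniz, Derivation.leibniz_pow, pderiv_zero_shiftedVar]

/-- This is where the characteristic enters: the power `X₁ ^ (d + 1)` has zero derivative. -/
theorem pderiv_one_coneForm (hd : ((d + 1 : ℕ) : R) = 0) :
    pderiv (Fin.succ ⟨0, m.succ_pos⟩) (coneForm R m d) = shiftedVar R m 1 ^ d := by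
  have hd' : ((d + 1 : ℕ) : MvPolynomial (Fin (m + 1 + 1)) R) = 0 := by
    rw [← map_natCast (C (σ := Fin (m + 1 + 1))), hd, map_zero]
  rw [coneForm, map_add, Derivation.leibniz_pow, ← Nat.cast_smul_eq_nsmul
    (MvPolynomial (Fin (m + 1 + 1)) R), hd', zero_smul, zero_add, map_sum,
    Finset.sum_eq_single 0]
  · simp only [Derivation.leibniz, Derivation.leibniz_pow, pderiv_succ_shiftedVar]
    simp
  · intro l _ hl
    simp only [Derivation.leibniz, Derivation.leibniz_pow, pderiv_succ_shiftedVar]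
    simp [hl]
  · simp

theorem pderiv_succ_coneForm {j : ℕ} (hj : j + 1 < m + 1) :
    pderiv (Fin.succ ⟨j + 1, hj⟩) (coneForm R m d) =
      shiftedVar R m (j + 2) ^ d + d * shiftedVar R m j * shiftedVar R m (j + 1) ^ (d - 1) := by
  rw [coneForm, map_add, map_sum]
  simp only [Derivation.leibniz, Derivation.leibniz_pow, pderiv_succ_shiftedVar, smul_eq_mul,
    nsmul_eq_mul, Finset.sum_add_distrib, mul_ite, mul_one, mul_zero, add_left_inj]
  rw [if_neg (by omega : ¬ 0 = j + 1), Finset.sum_ite_eq' (Finset.range (m + 1)),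
    Finset.sum_ite_eq' (Finset.range (m + 1)),
    if_pos (Finset.mem_range.2 (by omega)), if_pos (Finset.mem_range.2 (by omega))]
  simp
  ring

theorem isSingularAt_coneForm (hd : 1 ≤ d) (hd' : ((d + 1 : ℕ) : R) = 0) :
    IsSingularAt (coneForm R m d) (Pi.single 0 1) := by
  have hY : ∀ l, eval (Pi.single 0 1) (shiftedVar R m l) = 0 := by
    intro l
    rw [shiftedVar]
    split_ifs
    · simp
    · simp
  have hd0 : d ≠ 0 := by omega
  refine ⟨by simp [coneForm, hY, hd0], fun j => ?_⟩
  refine Fin.cases ?_ (fun j => ?_) j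
  · rw [pderiv_zero_coneForm, map_zero]
  · obtain ⟨j, hj⟩ := j
    rcases j with _ | j
    · rw [pderiv_one_coneForm hd']
      simp [hY, hd0]
    · rw [pderiv_succ_coneForm hj]
      simp [hY, hd0]

/-- The derivatives force every product `y l * y (l + 1) ^ d` to vanish, so the form reduces to `y 0
^ (d + 1)` at `x` and `y 0 = 0`. From `y 0 = y 1 = 0` the recursion given by the derivatives kills
the remaining coordinates in turn. -/
theorem eq_zero_of_isSingularAt_coneForm [IsDomain R] (hd : 1 ≤ d)
    (hd' : ((d + 1 : ℕ) : R) = 0) {x : Fin (m + 1 + 1) → R}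
    (hx : IsSingularAt (coneForm R m d) x) (hx0 : x 0 = 0) : x = 0 := by
  have hd0 : d ≠ 0 := by omega
  set y : ℕ → R := fun l => eval x (shiftedVar R m l)
  have h1 : y 1 = 0 := by
    have := hx.2 (Fin.succ ⟨0, m.succ_pos⟩)
    rw [pderiv_one_coneForm hd', map_pow] at this
    exact eq_zero_of_pow_eq_zero this
  have hrec : ∀ j, j + 1 < m + 1 → y (j + 2) ^ d + d * y j * y (j + 1) ^ (d - 1) = 0 := by
    intro j hj
    have := hx.2 (Fin.succ ⟨j + 1, hj⟩)
    rw [pderiv_succ_coneForm hj] at this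
    simpa using this
  have hprod : ∀ l, l < m + 1 → y l * y (l + 1) ^ d = 0 := by
    intro l
    induction l with
    | zero => intro _; rw [h1, zero_pow hd0, mul_zero]
    | succ l ih =>
      intro hl
      obtain ⟨e, rfl⟩ : ∃ e, d = e + 1 := ⟨d - 1, by omega⟩
      have h2 := hrec l hl
      have h3 := ih (by omega)
      rw [Nat.add_sub_cancel] at h2
      -- Multiplying the recursion by `y (l + 1)` raises `y (l + 1) ^ (d - 1)` to the power `d` that
      -- occurs in the previous product.
      linear_combination y (l + 1) * h2 - ((e + 1 : ℕ) : R) * h3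
  have h0 : y 0 = 0 := by
    have h2 := hx.1
    rw [coneForm, map_add, map_sum, Finset.sum_eq_zero, add_zero, map_pow] at h2
    · exact eq_zero_of_pow_eq_zero h2
    · intro l hl
      rw [map_mul, map_pow]
      exact hprod l (Finset.mem_range.1 hl)
  have hall : ∀ l, l < m + 1 → y l = 0 ∧ y (l + 1) = 0 := by
    intro l
    induction l with
    | zero => exact fun _ => ⟨h0, h1⟩
    | succ l ih =>
      intro hl
      obtain ⟨h2, h3⟩ := ih (by omega)
      have h4 := hrec l hl
      rw [h2, mul_zero, zero_mul, add_zero] at h4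
      exact ⟨h3, eq_zero_of_pow_eq_zero h4⟩
  ext j
  refine Fin.cases hx0 (fun j => ?_) j
  have := (hall j.1 j.2).1
  change eval x (shiftedVar R m j.1) = 0 at this
  rwa [shiftedVar, dif_pos j.2, eval_X] at this

end ConeForm

/-! ### The generic singular form has finitely many singular points -/

section Algebraicity

theorem homogeneousComponent_X_mul {σ R : Type*} [CommRing R] (i : σ) (m : ℕ)
    (q : MvPolynomial σ R) :
    homogeneousComponent (m + 1) (X i * q) = X i * homogeneousComponent m q := by
  have := DirectSum.coe_decompose_mul_add_of_left_mem (homogeneousSubmodule σ R) (i := 1) (j := m)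
    (b := q) ((mem_homogeneousSubmodule 1 _).2 (isHomogeneous_X R i))
  rw [add_comm m 1]
  refine Eq.trans ?_ (this.trans ?_)
  · exact (decomposition.decompose'_apply _ _).symm
  · exact congrArg _ (decomposition.decompose'_apply _ _)

variable {k : Type*} [Field k] {m d : ℕ}

/-- Some polynomial `g` in the coefficients does not vanish identically on singular forms and
has the property that singular forms outside its zero locus have no singular points on the
hyperplane `X 0 = 0`. -/
theorem exists_incidenceHom_ne_zero_of_natCast_eq_zero (hd : 1 ≤ d) (hd' : ((d + 1 : ℕ) : k) = 0) :
    ∃ (M : ℕ) (g : MvPolynomial (DegreeExponent (m + 1) (d + 1)) k),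
      incidenceHom k d (0 : Fin (m + 1 + 1)) g ≠ 0 ∧
      ∀ β : Fin (m + 1 + 1) →₀ ℕ, β.degree = M → C g * monomial β 1 ∈
        Ideal.span (insert (X 0) (insert (universalForm k (m + 1) (d + 1))
          (Set.range fun i => pderiv i (universalForm k (m + 1) (d + 1))))) := by
  let c₀ : MvPolynomial (DegreeExponent (m + 1) (d + 1)) k →ₐ[k] k :=
    aeval fun α => coeff α.1 (coneForm k m d)
  have hc₀ : (formOfCoeffs fun α : DegreeExponent (m + 1) (d + 1) => c₀ (X α)) =
      coneForm k m d := by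
    simp only [c₀, aeval_X]
    exact formOfCoeffs_coeff coneForm_isHomogeneous
  let L := AlgebraicClosure k
  have hdL : ((d + 1 : ℕ) : L) = 0 := by
    rw [← map_natCast (algebraMap k L), hd', map_zero]
  let c : MvPolynomial (DegreeExponent (m + 1) (d + 1)) k →+* L :=
    (algebraMap k L).comp c₀.toRingHom
  have hmap : map c (universalForm k (m + 1) (d + 1)) = coneForm L m d := by
    rw [← map_map, map_universalForm]
    change map (algebraMap k L) (formOfCoeffs fun α => c₀ (X α)) = _
    rw [hc₀]
    have hY : ∀ l, map (algebraMap k L) (shiftedVar k m l) = shiftedVar L m l := by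
      intro l
      rw [shiftedVar, shiftedVar]
      split_ifs <;> simp
    simp [coneForm, hY]
  obtain ⟨M, g, hg, hgM⟩ := exists_C_mul_monomial_mem_span c
    (insert (X 0) (insert (universalForm k (m + 1) (d + 1))
      (Set.range fun i => pderiv i (universalForm k (m + 1) (d + 1))))) (by
        rintro _ (rfl | rfl | ⟨i, rfl⟩)
        · exact ⟨_, isHomogeneous_X _ _⟩
        · exact ⟨_, formOfCoeffs_isHomogeneous _⟩
        · exact ⟨_, (formOfCoeffs_isHomogeneous _).pderiv⟩) (fun x hx => by
        refine eq_zero_of_isSingularAt_coneForm hd hdL ?_ (by simpa using hx (X 0) (by simp))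
        rw [← hmap]
        refine ⟨?_, fun i => ?_⟩
        · rw [eval_map]
          exact hx _ (by simp)
        · rw [pderiv_map, eval_map]
          exact hx _ (Or.inr (Or.inr ⟨i, rfl⟩)))
  refine ⟨M, g, fun h => hg ?_, hgM⟩
  -- The cone is singular at `(1 : 0 : … : 0)`, hence a specialisation of the generic singular form;
  -- a `g` nonzero at the cone cannot vanish generically.
  obtain ⟨ψ, hψ, -⟩ := exists_algHom_comp_incidenceHom (i := 0) (ξ := Pi.single 0 1) (by simp) c₀
    (by rw [hc₀]; exact isSingularAt_coneForm hd hd')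
  change algebraMap k L (c₀ g) = 0
  rw [← hψ, AlgHom.comp_apply, h, map_zero, map_zero]

/-- The coordinates of the chart of the incidence variety are algebraic over the coefficients
of the generic singular form. -/
theorem isAlgebraic_adjoin_range_incidenceHom (hd : 1 ≤ d) (hd' : ((d + 1 : ℕ) : k) = 0) :
    Algebra.IsAlgebraic
      (Algebra.adjoin k (Set.range fun α => incidenceHom k d (0 : Fin (m + 1 + 1)) (X α)))
      (MvPolynomial (ChartIndex (m + 1) d 0) k) := by
  set φ := incidenceHom k d (0 : Fin (m + 1 + 1)) with hφ
  set S := Algebra.adjoin k (Set.range fun α => φ (X α))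
  have hmemS : ∀ a, φ a ∈ S := by
    intro a
    induction a using MvPolynomial.induction_on with
    | C a => rw [← algebraMap_eq, AlgHom.commutes]; exact S.algebraMap_mem a
    | add p q hp hq => rw [map_add]; exact add_mem hp hq
    | mul_X p j hp => rw [map_mul]; exact mul_mem hp (Algebra.subset_adjoin ⟨j, rfl⟩)
  set ξ := chartPoint k d (0 : Fin (m + 1 + 1)) with hξ
  obtain ⟨M, g, hg, hgM⟩ := exists_incidenceHom_ne_zero_of_natCast_eq_zero (m := m) hd hd'
  let mon : (Fin (m + 1 + 1) →₀ ℕ) → MvPolynomial (ChartIndex (m + 1) d 0) k :=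
    fun β => eval ξ (monomial β 1)
  have hmon_add : ∀ β γ, mon (β + γ) = mon β * mon γ := by
    intro β γ
    simp only [mon]
    rw [← map_mul, monomial_mul, one_mul]
  have hmon_single : ∀ j, mon (Finsupp.single j 1) = ξ j := by
    intro j
    exact eval_X j
  -- The degree `M` monomials in the generic singular point span a finite `S`-module, which will be
  -- stable under multiplication by `φ g * ξ j`.
  let V : Submodule S (MvPolynomial (ChartIndex (m + 1) d 0) k) :=
    Submodule.span S (Set.range fun γ : DegreeExponent (m + 1) M => mon γ.1)
  have hVmem : ∀ F : MvPolynomial (Fin (m + 1 + 1)) (MvPolynomial _ k), F.IsHomogeneous M →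
      eval ξ (map φ.toRingHom F) ∈ V := by
    intro F hF
    rw [← formOfCoeffs_coeff hF, map_formOfCoeffs, formOfCoeffs, map_sum]
    refine Submodule.sum_mem _ fun γ _ => ?_
    have : eval ξ (monomial γ.1 ((φ.toRingHom ∘ fun α : DegreeExponent (m + 1) M =>
        coeff α.1 F) γ)) = (⟨φ (coeff γ.1 F), hmemS _⟩ : S) • mon γ.1 := by
      rw [← mul_one ((φ.toRingHom ∘ fun α : DegreeExponent (m + 1) M => coeff α.1 F) γ),
        ← C_mul_monomial, map_mul, eval_C]
      rfl
    rw [this]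
    exact Submodule.smul_mem _ _ (Submodule.subset_span ⟨γ, rfl⟩)
  have hstep : ∀ β : Fin (m + 1 + 1) →₀ ℕ, β.degree = M + 1 → φ g * mon β ∈ V := by
    intro β hβ
    have hmem : C g * monomial β 1 ∈ Ideal.span (insert (X 0)
        (insert (universalForm k (m + 1) (d + 1))
          (Set.range fun i => pderiv i (universalForm k (m + 1) (d + 1))))) := by
      obtain ⟨j, hj⟩ : ∃ j, β j ≠ 0 := by
        by_contra! h
        rw [show β = 0 from Finsupp.ext h] at hβ
        simp at hβ
      have hle : Finsupp.single j 1 ≤ β := by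
        simpa using Nat.one_le_iff_ne_zero.2 hj
      have h1 := add_tsub_cancel_of_le hle
      have h2 : (β - Finsupp.single j 1).degree = M := by
        have := congrArg Finsupp.degree h1
        rw [map_add, hβ, Finsupp.degree_single] at this
        omega
      rw [← h1, ← one_mul (1 : MvPolynomial (DegreeExponent (m + 1) (d + 1)) k), ← monomial_mul,
        mul_left_comm]
      exact Ideal.mul_mem_left _ _ (hgM _ h2)
    obtain ⟨q, z, hz, hqz⟩ := Ideal.mem_span_insert.1 hmem
    have hz' : homogeneousComponent (M + 1) z ∈ singularIdeal (universalForm k (m + 1) (d + 1)) :=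
      homogeneousComponent_mem_span (by
        rintro _ (rfl | ⟨i, rfl⟩)
        · exact ⟨_, formOfCoeffs_isHomogeneous _⟩
        · exact ⟨_, (formOfCoeffs_isHomogeneous _).pderiv⟩) hz _
    have hhom :
        (C g * monomial β (1 : MvPolynomial (DegreeExponent (m + 1) (d + 1)) k)).IsHomogeneous (M + 1) := by
      rw [C_mul_monomial]
      exact isHomogeneous_monomial _ hβ
    -- In degree `M + 1` the coefficient of `X 0` has degree `M`. At the generic singular point `X
    -- 0` becomes `1` and the singular ideal vanishes, so the degree drops from `M + 1` to `M`.
    have h3 := congrArg (homogeneousComponent (M + 1)) hqz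
    rw [homogeneousComponent_of_mem hhom, if_pos rfl, map_add, mul_comm q,
      homogeneousComponent_X_mul] at h3
    have h4 := map_mem_singularIdeal φ.toRingHom hz'
    rw [map_universalForm] at h4
    have h5 := (isSingularAt_incidenceHom (R := k) (d := d) (0 : Fin (m + 1 + 1))).eval_eq_zero h4
    have h6 := congrArg (fun F => eval ξ (map φ.toRingHom F)) h3
    simp only [map_add, map_mul, map_C, map_X, eval_C, eval_X, map_monomial, map_one] at h6
    rw [show eval ξ _ = 0 from h5, add_zero, hξ, chartPoint_self, one_mul] at h6
    change φ g * mon β = _ at h6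
    rw [h6]
    exact hVmem _ (homogeneousComponent_isHomogeneous M q)
  have hone : (1 : MvPolynomial (ChartIndex (m + 1) d 0) k) ∈ V := by
    refine Submodule.subset_span ⟨DegreeExponent.mk (Finsupp.single 0 M) (by simp), ?_⟩
    change mon (Finsupp.single 0 M) = 1
    simp only [mon]
    rw [← X_pow_eq_monomial, map_pow, eval_X, hξ, chartPoint_self, one_pow]
  have hξalg : ∀ j, IsAlgebraic S (ξ j) := by
    intro j
    -- The determinant trick on `V`, which is nonzero because it contains `1 = ξ 0 ^ M`.
    have hint : IsIntegral S (φ g * ξ j) := by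
      refine isIntegral_of_smul_mem_submodule V (fun h => ?_)
        (Submodule.fg_span (Set.finite_range _)) _ fun v hv => ?_
      · rw [h] at hone
        exact one_ne_zero ((Submodule.mem_bot S).1 hone)
      · induction hv using Submodule.span_induction with
        | mem v hv =>
          obtain ⟨γ, rfl⟩ := hv
          have := hstep (Finsupp.single j 1 + γ.1) (by
            rw [map_add, γ.degree_eq, Finsupp.degree_single, add_comm])
          rwa [hmon_add, hmon_single, ← mul_assoc] at this
        | zero => rw [smul_zero]; exact V.zero_mem
        | add v w _ _ hv hw => rw [smul_add]; exact V.add_mem hv hw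
        | smul s v _ hv => rw [smul_comm]; exact V.smul_mem s hv
    have halg : IsAlgebraic S ((⟨φ g, hmemS g⟩ : S) • ξ j) := hint.isAlgebraic
    refine IsAlgebraic.of_smul (mem_nonZeroDivisors_of_ne_zero fun h => hg ?_) halg
    exact congrArg Subtype.val h
  refine ⟨fun b => ?_⟩
  induction b using MvPolynomial.induction_on with
  | C a =>
    exact isAlgebraic_algebraMap (⟨C a, S.algebraMap_mem a⟩ : S)
  | add p q hp hq => exact hp.add hq
  | mul_X p j hp =>
    refine hp.mul ?_
    rcases j with j | β
    · have := hξalg j.1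
      rwa [hξ, chartPoint, dif_neg j.2] at this
    · have h1 : φ (X β.1) = X (Sum.inr β) := by
        rw [hφ, incidenceHom_X, genericCoeffs, chartCoeffs_farExponent]
      rw [← h1]
      exact isAlgebraic_algebraMap (⟨φ (X β.1), hmemS _⟩ : S)

/-- All but one of the coefficients of the generic singular form are algebraically independent. -/
theorem exists_algebraicIndependent_incidenceHom (hd : 1 ≤ d) (hd' : ((d + 1 : ℕ) : k) = 0) :
    ∃ α₀ : DegreeExponent (m + 1) (d + 1), AlgebraicIndependent k
      fun α : {α // α ≠ α₀} => incidenceHom k d (0 : Fin (m + 1 + 1)) (X α.1) := by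
  set x := fun α => incidenceHom k d (0 : Fin (m + 1 + 1)) (X α) with hx
  have := isAlgebraic_adjoin_range_incidenceHom (m := m) hd hd'
  -- By algebraicity a transcendence basis can be chosen among the coefficients. It has as many
  -- elements as the chart has coordinates, one fewer than there are coefficients, so exactly one
  -- index `α₀` is left out.
  obtain ⟨t, ht, hbasis⟩ := exists_isTranscendenceBasis_subset (R := k) (Set.range x)
  choose σ hσ using fun b : t => ht b.2
  have hσinj : Function.Injective σ := by
    intro a b hab
    rw [Subtype.ext_iff, ← hσ a, ← hσ b, hab]
  have hcard : Nat.card t = Nat.card (ChartIndex (m + 1) d (0 : Fin (m + 1 + 1))) := by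
    have h1 := hbasis.lift_cardinalMk_eq (IsTranscendenceBasis.mvPolynomial
      (ChartIndex (m + 1) d (0 : Fin (m + 1 + 1))) k)
    have h2 := congrArg Cardinal.toNat h1
    rwa [Cardinal.toNat_lift, Cardinal.toNat_lift] at h2
  have hcard' := card_chartIndex_add_one (d := d) (0 : Fin (m + 1 + 1))
  have hrange : (Set.range σ).ncard = Nat.card t := by
    rw [← Nat.card_coe_set_eq, Nat.card_range_of_injective hσinj]
  obtain ⟨α₀, hα₀⟩ : ∃ α₀, α₀ ∉ Set.range σ := by
    by_contra! h
    rw [Set.eq_univ_of_forall h, Set.ncard_univ] at hrange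
    omega
  refine ⟨α₀, ?_⟩
  have hcompl : Set.range σ = {α₀}ᶜ := by
    refine Set.eq_of_subset_of_ncard_le (fun α hα h => hα₀ (h ▸ hα)) ?_
    have := Set.ncard_add_ncard_compl {α₀}
    rw [Set.ncard_singleton] at this
    omega
  have hmem : ∀ α : {α // α ≠ α₀}, ∃ b : t, σ b = α.1 := fun α => by
    have : α.1 ∈ Set.range σ := by rw [hcompl]; exact α.2
    exact this
  choose τ hτ using hmem
  have hτinj : Function.Injective τ := by
    intro a b hab
    rw [Subtype.ext_iff, ← hτ a, ← hτ b, hab]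
  have h3 := hbasis.1.comp τ hτinj
  convert h3 using 1
  ext1 α
  rw [Function.comp_apply, ← hσ, hτ]

end Algebraicity

/-! ### Principal prime ideals -/

section Principal

/-- A nonzero prime ideal of `R[Y]` with trivial contraction to the factorial ring `R` is
principal. -/
theorem Polynomial.exists_eq_span_singleton_of_comap_C_eq_bot {R : Type*} [CommRing R] [IsDomain R]
    [UniqueFactorizationMonoid R] (P : Ideal (Polynomial R)) [hP : P.IsPrime] (hP0 : P ≠ ⊥)
    (hPC : ∀ a : R, Polynomial.C a ∈ P → a = 0) : ∃ g, P = Ideal.span {g} := by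
  classical
  obtain ⟨_⟩ : Nonempty (NormalizedGCDMonoid R) := inferInstance
  have hex : ∃ N, ∃ h ∈ P, h ≠ 0 ∧ h.natDegree = N := by
    obtain ⟨h, hh, h0⟩ := Submodule.exists_mem_ne_zero_of_ne_bot hP0
    exact ⟨_, h, hh, h0, rfl⟩
  obtain ⟨h, hh, h0, hN⟩ := Nat.find_spec hex
  have hmin : ∀ a ∈ P, a.natDegree < h.natDegree → a = 0 := by
    intro a ha hlt
    by_contra ha0
    exact Nat.find_min hex (hN ▸ hlt) ⟨a, ha, ha0, rfl⟩
  -- The content of `h` is a nonzero constant, hence not in the prime `P`, so the primitive part is.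
  have hg : h.primPart ∈ P := by
    rw [h.eq_C_content_mul_primPart] at hh
    refine (hP.mem_or_mem hh).resolve_left fun hc => h0 ?_
    exact Polynomial.content_eq_zero_iff.1 (hPC _ hc)
  have hgdeg : h.primPart.natDegree = h.natDegree := Polynomial.natDegree_primPart h
  refine ⟨h.primPart, le_antisymm (fun f hf => ?_) ((Ideal.span_singleton_le_iff_mem _).2 hg)⟩
  rw [Ideal.mem_span_singleton]
  let K := FractionRing R
  refine h.isPrimitive_primPart.dvd_of_fraction_map_dvd_fraction_map (K := K) ?_
  let ι := Polynomial.mapRingHom (algebraMap R K)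
  have hι : Function.Injective ι := Polynomial.map_injective _ (IsFractionRing.injective R K)
  have hg0 : ι h.primPart ≠ 0 := by
    rw [Ne, map_eq_zero_iff ι hι]
    exact Polynomial.primPart_ne_zero h
  have hdiv := EuclideanDomain.div_add_mod (ι f) (ι h.primPart)
  set r := ι f % ι h.primPart
  have hrdeg : r.degree < (ι h.primPart).degree := EuclideanDomain.mod_lt _ hg0
  have hrmem : r ∈ P.map ι := by
    have : r = ι f - ι h.primPart * (ι f / ι h.primPart) :=
      eq_sub_of_add_eq' hdiv
    rw [this]
    exact sub_mem (Ideal.mem_map_of_mem _ hf) (Ideal.mul_mem_right _ _ (Ideal.mem_map_of_mem _ hg))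
  let : Algebra (Polynomial R) (Polynomial K) := ι.toAlgebra
  have : IsLocalization ((nonZeroDivisors R).map Polynomial.C) (Polynomial K) :=
    Polynomial.isLocalization _ _
  obtain ⟨⟨⟨a, ha⟩, ⟨_, s, hs, rfl⟩⟩, has⟩ := (IsLocalization.mem_map_algebraMap_iff
    ((nonZeroDivisors R).map (Polynomial.C : R →+* Polynomial R)) (Polynomial K)).1 hrmem
  replace has : r * ι (Polynomial.C s) = ι a := has
  have hs0 : algebraMap R K s ≠ 0 := by
    rw [Ne, map_eq_zero_iff _ (IsFractionRing.injective R K)]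
    exact nonZeroDivisors.ne_zero hs
  have hιC : ι (Polynomial.C s) = Polynomial.C (algebraMap R K s) := Polynomial.map_C _
  -- Clearing denominators in the remainder would give a nonzero element of `P` of degree smaller
  -- than that of `h`. Divisibility over `K` then descends to `R` by Gauss's lemma.
  have hr0 : r = 0 := by
    by_contra hr0
    have hlt : a.natDegree < h.natDegree := by
      have h1 : (ι a).natDegree = a.natDegree :=
        Polynomial.natDegree_map_eq_of_injective (IsFractionRing.injective R K) a
      have h2 : (ι h.primPart).natDegree = h.primPart.natDegree :=
        Polynomial.natDegree_map_eq_of_injective (IsFractionRing.injective R K) _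
      rw [← h1, ← has, hιC, Polynomial.natDegree_mul_C hs0, ← hgdeg, ← h2]
      exact Polynomial.natDegree_lt_natDegree hr0 hrdeg
    have ha0 := hmin a ha hlt
    rw [ha0, map_zero, hιC] at has
    exact (mul_ne_zero hr0 (Polynomial.C_ne_zero.2 hs0)) has
  rw [hr0, add_zero] at hdiv
  exact ⟨_, hdiv.symm⟩

/-- A nonzero prime ideal of a polynomial ring over a factorial ring which contains no nonzero
polynomial independent of one of the variables is generated by a prime element. -/
theorem MvPolynomial.exists_prime_eq_span_singleton {R σ : Type*} [CommRing R] [IsDomain R]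
    [UniqueFactorizationMonoid R] (P : Ideal (MvPolynomial σ R)) [hP : P.IsPrime] (hP0 : P ≠ ⊥)
    (s : σ) (hs : ∀ a : MvPolynomial {t // t ≠ s} R, rename Subtype.val a ∈ P → a = 0) :
    ∃ g, Prime g ∧ P = Ideal.span {g} := by
  classical
  let e : MvPolynomial σ R ≃ₐ[R] Polynomial (MvPolynomial {t // t ≠ s} R) :=
    (renameEquiv R (Equiv.optionSubtypeNe s).symm).trans (optionEquivLeft R {t // t ≠ s})
  have heC : ∀ a, e (rename Subtype.val a) = Polynomial.C a := by
    intro a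
    induction a using MvPolynomial.induction_on with
    | C a => simp [e]
    | add p q hp hq => rw [map_add, map_add, hp, hq, map_add]
    | mul_X p j hp =>
      rw [map_mul, map_mul, hp, rename_X, map_mul]
      congr 1
      simp [e, Equiv.optionSubtypeNe_symm_of_ne j.2]
  let P' : Ideal (Polynomial (MvPolynomial {t // t ≠ s} R)) := P.comap e.symm
  have hP' : P'.IsPrime := Ideal.comap_isPrime _ _
  have hP'0 : P' ≠ ⊥ := by
    obtain ⟨h, hh, h0⟩ := Submodule.exists_mem_ne_zero_of_ne_bot hP0
    refine (Submodule.ne_bot_iff _).2 ⟨e h, ?_, by simpa using h0⟩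
    change e.symm (e h) ∈ P
    rwa [e.symm_apply_apply]
  obtain ⟨g, hg⟩ := Polynomial.exists_eq_span_singleton_of_comap_C_eq_bot P' hP'0 fun a ha => by
    refine hs a ?_
    rw [← heC] at ha
    change e.symm (e _) ∈ P at ha
    rwa [e.symm_apply_apply] at ha
  have hPg : P = Ideal.span {e.symm g} := by
    ext f
    have h1 : f ∈ P ↔ e f ∈ P' := by
      change f ∈ P ↔ e.symm (e f) ∈ P
      rw [e.symm_apply_apply]
    rw [h1, hg, Ideal.mem_span_singleton, Ideal.mem_span_singleton]
    constructor
    · intro h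
      simpa using map_dvd e.symm h
    · intro h
      simpa using map_dvd e h
  refine ⟨e.symm g, ?_, hPg⟩
  rw [← Ideal.span_singleton_prime, ← hPg]
  · exact hP
  · rintro h
    rw [h, Ideal.span_singleton_zero] at hPg
    exact hP0 hPg

end Principal

/-! ### Generators of the discriminant ideal -/

section Generators

/-- Dimension count: the chart has one coordinate fewer than there are coefficients, so
`incidenceHom` cannot be injective. -/
theorem discriminantIdeal_ne_bot {R : Type*} [CommRing R] [IsDomain R] {n d : ℕ} :
    discriminantIdeal R n d ≠ ⊥ := by
  intro h
  have hinj : AlgebraicIndependent R (genericCoeffs R d (0 : Fin (n + 1))) :=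
    (RingHom.injective_iff_ker_eq_bot (incidenceHom R d (0 : Fin (n + 1)))).2 h
  have h1 := hinj.lift_cardinalMk_le_trdeg
  rw [MvPolynomial.trdeg_of_isDomain] at h1
  have h2 := Cardinal.toNat_le_toNat h1 (by
    simp only [Cardinal.lift_lt_aleph0]
    exact Cardinal.lt_aleph0_of_finite _)
  simp only [Cardinal.toNat_lift] at h2
  have h3 := card_chartIndex_add_one (d := d) (0 : Fin (n + 1))
  simp only [Nat.card] at h3
  omega

/-- The elements of the discriminant ideal vanish at singular forms with coefficients in
arbitrary rings. -/
theorem eq_zero_of_mem_discriminantIdeal {R T : Type*} [CommRing R] [IsDomain R] [CommRing T]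
    {n d : ℕ} {g : MvPolynomial (DegreeExponent n (d + 1)) R} (hg : g ∈ discriminantIdeal R n d)
    (c : MvPolynomial (DegreeExponent n (d + 1)) R →+* T) {i : Fin (n + 1)} {x : Fin (n + 1) → T}
    (hxi : x i = 1) (hx : IsSingularAt (formOfCoeffs fun α => c (X α)) x) : c g = 0 := by
  obtain ⟨M, hM⟩ := exists_pow_mul_mem_of_mem_discriminantIdeal hg i
  have h := pow_mul_eq_zero_of_mem_singularIdeal hM c hx
  rwa [hxi, one_pow, one_mul] at h

/-- Membership is witnessed by a relation in the universal singular ideal, and such a relation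
survives every base change. This permits reduction from `ℤ` to `k`. -/
theorem map_mem_discriminantIdeal {R S : Type*} [CommRing R] [IsDomain R] [CommRing S] {n d : ℕ}
    (f : R →+* S) {g : MvPolynomial (DegreeExponent n (d + 1)) R}
    (hg : g ∈ discriminantIdeal R n d) : map f g ∈ discriminantIdeal S n d := by
  refine eq_zero_of_mem_discriminantIdeal hg
    ((incidenceHom S d (0 : Fin (n + 1))).toRingHom.comp (map f)) (chartPoint_self 0) ?_
  simp only [RingHom.comp_apply, map_X]
  exact isSingularAt_incidenceHom 0

/-- The homogeneous components of an element of the discriminant ideal are in the ideal. -/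
theorem homogeneousComponent_mem_discriminantIdeal {R : Type*} [CommRing R] [IsDomain R] {n d : ℕ}
    {g : MvPolynomial (DegreeExponent n (d + 1)) R} (hg : g ∈ discriminantIdeal R n d) (N : ℕ) :
    homogeneousComponent N g ∈ discriminantIdeal R n d := by
  let φ := incidenceHom R d (0 : Fin (n + 1))
  let B := MvPolynomial (ChartIndex n d (0 : Fin (n + 1))) R
  -- The generic singular form scaled by an indeterminate `t` is still singular, so `g` vanishes on
  -- it; the coefficient of `t ^ N` is the value of the degree `N` component.
  let c : MvPolynomial (DegreeExponent n (d + 1)) R →ₐ[R] Polynomial B :=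
    aeval fun α => Polynomial.X * Polynomial.C (φ (X α))
  have hhom : ∀ (D : ℕ) (h : MvPolynomial (DegreeExponent n (d + 1)) R), h.IsHomogeneous D →
      c h = Polynomial.monomial D (φ h) := by
    intro D h hh
    rw [h.as_sum, map_sum, map_sum, map_sum]
    refine Finset.sum_congr rfl fun m hm => ?_
    have hm' : m.degree = D := by
      by_contra hne
      exact mem_support_iff.1 hm (hh.coeff_eq_zero hne)
    have h1 : φ (monomial m (coeff m h)) =
        algebraMap R B (coeff m h) * m.prod fun α e => φ (X α) ^ e := by
      have : φ = aeval fun α => φ (X α) := by ext α; simp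
      conv_lhs => rw [this, aeval_monomial]
    rw [h1, aeval_monomial]
    simp only [mul_pow, Finsupp.prod_mul, ← map_pow]
    rw [Finsupp.prod, Finset.prod_pow_eq_pow_sum, Finsupp.prod, ← map_prod,
      show ∑ i ∈ m.support, m i = D from hm', IsScalarTower.algebraMap_apply R B (Polynomial B),
      Polynomial.algebraMap_eq, mul_left_comm, ← map_mul, mul_comm,
      Polynomial.C_mul_X_pow_eq_monomial]
    rfl
  have hcg : c g = 0 := by
    refine eq_zero_of_mem_discriminantIdeal hg c.toRingHom (i := 0)
      (x := fun j => Polynomial.C (chartPoint R d 0 j)) (by rw [chartPoint_self, map_one]) ?_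
    have h1 : (fun α => c.toRingHom (X α)) = (Polynomial.X : Polynomial B) •
        ((Polynomial.C : B →+* Polynomial B) ∘ fun α => φ (X α)) := by
      ext1 α
      change c (X α) = _
      simp [c]
    have h2 := (isSingularAt_incidenceHom (R := R) (d := d) (0 : Fin (n + 1))).map
      (Polynomial.C : B →+* Polynomial B)
    rw [map_formOfCoeffs] at h2
    rw [h1, formOfCoeffs_smul]
    refine ⟨?_, fun j => ?_⟩
    · rw [map_mul]
      exact mul_eq_zero_of_right _ h2.1
    · rw [pderiv_C_mul, map_mul]
      exact mul_eq_zero_of_right _ (h2.2 j)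
  have h3 : c g = ∑ i ∈ Finset.range (g.totalDegree + 1),
      Polynomial.monomial i (φ (homogeneousComponent i g)) := by
    conv_lhs => rw [← sum_homogeneousComponent g]
    rw [map_sum]
    exact Finset.sum_congr rfl fun i _ => hhom i _ (homogeneousComponent_isHomogeneous i g)
  by_cases hN : N ≤ g.totalDegree
  · have h4 := congrArg (fun q => Polynomial.coeff q N) (h3.symm.trans hcg)
    simp only [Polynomial.finsetSum_coeff, Polynomial.coeff_monomial, Polynomial.coeff_zero] at h4
    rw [Finset.sum_ite_eq', if_pos (Finset.mem_range.2 (by omega))] at h4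
    exact h4
  · rw [homogeneousComponent_eq_zero _ _ (by omega)]
    exact zero_mem _

/-- A generator of a homogeneous principal ideal is homogeneous. -/
theorem MvPolynomial.exists_isHomogeneous_of_homogeneousComponent_mem {σ R : Type*} [CommRing R]
    [IsDomain R] {f : MvPolynomial σ R}
    (hf : ∀ N, homogeneousComponent N f ∈ Ideal.span {f}) : ∃ N, f.IsHomogeneous N := by
  rcases eq_or_ne f 0 with rfl | hf0
  · exact ⟨0, isHomogeneous_zero _ _ _⟩
  obtain ⟨q, hq⟩ := Ideal.mem_span_singleton.1 (hf f.totalDegree)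
  have htop : homogeneousComponent f.totalDegree f ≠ 0 := by
    intro h
    obtain ⟨m, hm, hmd⟩ := Finset.exists_mem_eq_sup f.support (support_nonempty.2 hf0)
      (fun m => m.sum fun _ e => e)
    have h1 := congrArg (coeff m) h
    rw [coeff_homogeneousComponent, if_pos, coeff_zero] at h1
    · exact mem_support_iff.1 hm h1
    · exact hmd.symm
  have hq0 : q ≠ 0 := by
    rintro rfl
    exact htop (by rw [hq, mul_zero])
  -- The top component is a multiple of `f` of the same total degree, so it is a constant times `f`.
  have hdeg : q.totalDegree = 0 := by
    have h1 : (homogeneousComponent f.totalDegree f).totalDegree = f.totalDegree :=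
      (homogeneousComponent_isHomogeneous _ _).totalDegree htop
    rw [hq, totalDegree_mul_of_isDomain hf0 hq0] at h1
    omega
  rw [totalDegree_eq_zero_iff_eq_C] at hdeg
  set a := coeff 0 q
  have ha : a ≠ 0 := by
    intro ha
    rw [ha, map_zero] at hdeg
    exact hq0 hdeg
  refine ⟨f.totalDegree, fun m hm => ?_⟩
  have h2 := homogeneousComponent_isHomogeneous f.totalDegree f
  refine h2 (d := m) ?_
  rw [hq, hdeg, mul_comm, coeff_C_mul]
  exact mul_ne_zero ha hm

variable {k : Type*} [Field k] {m d : ℕ}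

theorem eq_zero_of_rename_mem_discriminantIdeal {α₀ : DegreeExponent (m + 1) (d + 1)}
    (hα₀ : AlgebraicIndependent k
      fun α : {α // α ≠ α₀} => incidenceHom k d (0 : Fin (m + 1 + 1)) (X α.1))
    {a : MvPolynomial {α // α ≠ α₀} k}
    (ha : rename Subtype.val a ∈ discriminantIdeal k (m + 1) d) : a = 0 := by
  refine (injective_iff_map_eq_zero (aeval _)).1 hα₀ a ?_
  have h1 : incidenceHom k d (0 : Fin (m + 1 + 1)) (rename Subtype.val a) = 0 := ha
  rw [incidenceHom, aeval_rename] at h1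
  simp only [incidenceHom_X]
  exact h1

theorem exists_prime_discriminantIdeal_eq (hd : 1 ≤ d) (hd' : ((d + 1 : ℕ) : k) = 0) :
    ∃ f, Prime f ∧ discriminantIdeal k (m + 1) d = Ideal.span {f} := by
  obtain ⟨α₀, hα₀⟩ := exists_algebraicIndependent_incidenceHom (m := m) hd hd'
  refine MvPolynomial.exists_prime_eq_span_singleton _ discriminantIdeal_ne_bot α₀ fun a ha => ?_
  exact eq_zero_of_rename_mem_discriminantIdeal hα₀ ha

/-- Algebraic independence lifts from characteristic `p`: a relation over `ℤ` can be divided by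
powers of `p` until its reduction is nonzero, while independence over `k` forces that reduction to
vanish. -/
theorem exists_prime_discriminantIdeal_int_eq (p : ℕ) [Fact p.Prime] [CharP k p] (hd : 1 ≤ d)
    (hd' : ((d + 1 : ℕ) : k) = 0) :
    ∃ Δ, Prime Δ ∧ discriminantIdeal ℤ (m + 1) d = Ideal.span {Δ} := by
  obtain ⟨α₀, hα₀⟩ := exists_algebraicIndependent_incidenceHom (m := m) hd hd'
  refine MvPolynomial.exists_prime_eq_span_singleton _ discriminantIdeal_ne_bot α₀ fun a ha => ?_
  by_contra ha0
  have hpu : ¬ IsUnit (C (p : ℤ) : MvPolynomial {α // α ≠ α₀} ℤ) :=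
    ((prime_C_iff _).2 (Nat.prime_iff_prime_int.1 Fact.out)).not_isUnit
  obtain ⟨e, b, hb, rfl⟩ := WfDvdMonoid.max_power_factor' ha0 hpu
  have hbI : rename Subtype.val b ∈ discriminantIdeal ℤ (m + 1) d := by
    rw [map_mul, map_pow, rename_C] at ha
    refine (Ideal.IsPrime.mem_or_mem inferInstance ha).resolve_left fun h => ?_
    have h1 := Ideal.IsPrime.mem_of_pow_mem inferInstance e h
    have h2 : incidenceHom ℤ d (0 : Fin (m + 1 + 1)) (C (p : ℤ)) = 0 := h1
    rw [← algebraMap_eq, AlgHom.commutes, algebraMap_eq, C_eq_zero] at h2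
    exact (Fact.out : p.Prime).ne_zero (by exact_mod_cast h2)
  have hbk := map_mem_discriminantIdeal (Int.castRingHom k) hbI
  rw [map_rename] at hbk
  have h2 := eq_zero_of_rename_mem_discriminantIdeal hα₀ hbk
  refine hb ((C_dvd_iff_zmod p b).2 ?_)
  apply map_injective (ZMod.castHom (dvd_refl p) k) (RingHom.injective _)
  rw [map_map, map_zero, ← h2]
  exact congrArg (fun f => map f b) (RingHom.ext_int _ _)

end Generators

/-! ### Irreducible hypersurfaces in projective space -/

section Divisor

theorem exists_X_notMem_span_singleton {σ R : Type*} [CommRing R] [IsDomain R] [Nontrivial σ]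
    {f : MvPolynomial σ R} (hf : Prime f) : ∃ s, X s ∉ Ideal.span {f} := by
  by_contra! h
  obtain ⟨s, t, hst⟩ := exists_pair_ne σ
  have hs := Ideal.mem_span_singleton.1 (h s)
  have ht := Ideal.mem_span_singleton.1 (h t)
  have hs' : f ∣ X s → X s ∣ f := hf.irreducible.dvd_symm (X_prime (R := R)).irreducible
  exact hst (X_dvd_X.1 ((hs' hs).trans ht))

variable {σ k : Type*} [Field k]

/-- A homogeneous prime ideal which does not contain all variables, as a point of projective
space. -/
def ProjectiveSpectrum.ofIdeal (P : Ideal (MvPolynomial σ k)) [P.IsPrime]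
    (hom : P.IsHomogeneous (homogeneousSubmodule σ k)) {s : σ} (hs : X s ∉ P) :
    ProjectiveSpectrum (homogeneousSubmodule σ k) where
  asHomogeneousIdeal := ⟨P, hom⟩
  isPrime := inferInstance
  not_irrelevant_le h := by
    refine hs (h ?_)
    rw [HomogeneousIdeal.mem_irrelevant_iff]
    change (DirectSum.decompose (homogeneousSubmodule σ k) (X s) 0 : MvPolynomial σ k) = 0
    exact DirectSum.decompose_of_mem_ne _
      ((mem_homogeneousSubmodule 1 _).2 (isHomogeneous_X k s)) one_ne_zero

theorem ProjectiveSpectrum.closure_ofIdeal (P : Ideal (MvPolynomial σ k)) [P.IsPrime]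
    (hom : P.IsHomogeneous (homogeneousSubmodule σ k)) {s : σ} (hs : X s ∉ P) :
    closure {ProjectiveSpectrum.ofIdeal P hom hs} =
      ProjectiveSpectrum.zeroLocus (homogeneousSubmodule σ k) (P : Set (MvPolynomial σ k)) := by
  rw [← ProjectiveSpectrum.zeroLocus_vanishingIdeal_eq_closure,
    ProjectiveSpectrum.vanishingIdeal_singleton]
  rfl

theorem isHomogeneous_span_singleton {f : MvPolynomial σ k} (hf : ∃ N, f.IsHomogeneous N) :
    (Ideal.span {f}).IsHomogeneous (homogeneousSubmodule σ k) := by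
  refine Ideal.homogeneous_span _ _ fun g hg => ?_
  obtain ⟨N, hN⟩ := hf
  rw [Set.mem_singleton_iff.1 hg]
  exact ⟨N, hN⟩

/-- An irreducible closed subset which properly contains an irreducible hypersurface is the whole
projective space. -/
theorem eq_univ_of_zeroLocus_ssubset {f : MvPolynomial σ k} (hf : Prime f)
    (hom : ∃ N, f.IsHomogeneous N) {s : σ} (hs : X s ∉ Ideal.span {f})
    {W : Set (ProjectiveSpectrum (homogeneousSubmodule σ k))} (hWirr : IsIrreducible W)
    (hWcl : IsClosed W)
    (hlt : ProjectiveSpectrum.zeroLocus (homogeneousSubmodule σ k) {f} ⊂ W) :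
    W = Set.univ := by
  have hfp : (Ideal.span {f}).IsPrime := (Ideal.span_singleton_prime hf.ne_zero).2 hf
  let P := ProjectiveSpectrum.ofIdeal (Ideal.span {f}) (isHomogeneous_span_singleton hom) hs
  have hPW : P ∈ W := hlt.1 fun g hg => by
    rw [Set.mem_singleton_iff.1 hg]
    exact Ideal.mem_span_singleton_self f
  let Q := ProjectiveSpectrum.vanishingIdeal W
  -- Elements of `Q` are divisible by `f` because `W` contains the generic point `P` of the
  -- hypersurface. Since `W` is irreducible and not contained in `V(f)`, dividing by `f` stays in
  -- `Q`, so a nonzero element would be divisible by `f` without end.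
  have hdvd : ∀ g ∈ Q, f ∣ g := fun g hg =>
    Ideal.mem_span_singleton.1 ((ProjectiveSpectrum.mem_vanishingIdeal W g).1 hg P hPW)
  have hdiv : ∀ g, f * g ∈ Q → g ∈ Q := by
    intro g hg
    rw [ProjectiveSpectrum.mem_vanishingIdeal] at hg ⊢
    have hsub : W ⊆ ProjectiveSpectrum.zeroLocus (homogeneousSubmodule σ k) {f} ∪
        ProjectiveSpectrum.zeroLocus (homogeneousSubmodule σ k) {g} := by
      intro x hx
      rw [← ProjectiveSpectrum.zeroLocus_singleton_mul]
      exact fun a ha => by rw [Set.mem_singleton_iff.1 ha]; exact hg x hx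
    rcases isPreirreducible_iff_isClosed_union_isClosed.1 hWirr.2 _ _
      (ProjectiveSpectrum.isClosed_zeroLocus _ _) (ProjectiveSpectrum.isClosed_zeroLocus _ _)
      hsub with h | h
    · exact absurd h hlt.2
    · exact fun x hx => h hx rfl
  have hQ : ∀ g ∈ Q, g = 0 := by
    intro g hg
    by_contra hg0
    obtain ⟨e, b, hb, rfl⟩ := WfDvdMonoid.max_power_factor hg0 hf.irreducible
    have : b ∈ Q := by
      clear hg0
      induction e with
      | zero => simpa using hg
      | succ e ih =>
        refine ih (hdiv _ ?_)
        rwa [← mul_assoc, ← pow_succ']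
    exact hb (hdvd b this)
  rw [← hWcl.closure_eq, ← ProjectiveSpectrum.zeroLocus_vanishingIdeal_eq_closure]
  refine Set.eq_univ_of_forall fun x g hg => ?_
  rw [hQ g hg]
  exact zero_mem _

theorem isIrreducibleDivisor_zeroLocus [Nontrivial σ] {f : MvPolynomial σ k} (hf : Prime f)
    (hom : ∃ N, f.IsHomogeneous N) :
    IsIrreducibleDivisor (ProjectiveSpectrum.zeroLocus (homogeneousSubmodule σ k) {f}) := by
  obtain ⟨s, hs⟩ := exists_X_notMem_span_singleton hf
  have hfp : (Ideal.span {f}).IsPrime := (Ideal.span_singleton_prime hf.ne_zero).2 hf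
  have hirr : IsIrreducible (ProjectiveSpectrum.zeroLocus (homogeneousSubmodule σ k) {f}) := by
    rw [← ProjectiveSpectrum.zeroLocus_span,
      ← ProjectiveSpectrum.closure_ofIdeal _ (isHomogeneous_span_singleton hom) hs]
    exact isIrreducible_singleton.closure
  have hs0 : X s ∉ (⊥ : Ideal (MvPolynomial σ k)) := by
    rw [Ideal.mem_bot]
    exact X_ne_zero s
  have huniv : IsIrreducible
      (Set.univ : Set (ProjectiveSpectrum (homogeneousSubmodule σ k))) := by
    rw [← ProjectiveSpectrum.zeroLocus_bot,
      ← ProjectiveSpectrum.closure_ofIdeal _ (Ideal.IsHomogeneous.bot _) hs0]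
    exact isIrreducible_singleton.closure
  refine ⟨hirr, ProjectiveSpectrum.isClosed_zeroLocus _ _, le_antisymm ?_ ?_⟩
  · refine (Order.coheight_le_coe_iff (n := 1)).2 fun W hW => ?_
    have hWu := eq_univ_of_zeroLocus_ssubset hf hom hs W.isIrreducible W.isClosed hW
    have : IsMax W := fun V _ => by
      change (V : Set (ProjectiveSpectrum (homogeneousSubmodule σ k))) ⊆ W.carrier
      rw [show W.carrier = Set.univ from hWu]
      exact Set.subset_univ _
    rw [Order.coheight_eq_zero.2 this]
    exact zero_lt_one
  · rw [Order.one_le_iff_ne_zero, Order.coheight_ne_zero]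
    intro hmax
    have hle : (⟨_, hirr, ProjectiveSpectrum.isClosed_zeroLocus _ _⟩ :
        TopologicalSpace.IrreducibleCloseds (ProjectiveSpectrum (homogeneousSubmodule σ k))) ≤
        ⟨Set.univ, huniv, isClosed_univ⟩ := Set.subset_univ _
    have h1 : Set.univ ⊆ ProjectiveSpectrum.zeroLocus (homogeneousSubmodule σ k) {f} := hmax hle
    have h2 := h1 (Set.mem_univ
      (ProjectiveSpectrum.ofIdeal ⊥ (Ideal.IsHomogeneous.bot _) hs0)) (Set.mem_singleton f)
    exact hf.ne_zero h2

/-- If the same prime ideals contain `f` and `g`, where `f` is prime, then `g` is a power of `f`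
up to a unit. -/
theorem exists_eq_mul_pow_of_forall_mem_iff {A : Type*} [CommRing A] [IsDomain A]
    [UniqueFactorizationMonoid A] {f g : A} (hf : Prime f)
    (h : ∀ P : Ideal A, P.IsPrime → (f ∈ P ↔ g ∈ P)) :
    ∃ (e : ℕ) (b : A), 1 ≤ e ∧ IsUnit b ∧ g = b * f ^ e := by
  have hg0 : g ≠ 0 := fun hg =>
    hf.ne_zero ((Ideal.mem_bot).1 ((h ⊥ Ideal.isPrime_bot).2 (Ideal.mem_bot.2 hg)))
  obtain ⟨e, b, hb, hgb⟩ := WfDvdMonoid.max_power_factor hg0 hf.irreducible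
  refine ⟨e, b, ?_, ?_, by rw [hgb, mul_comm]⟩
  · rw [Nat.one_le_iff_ne_zero]
    rintro rfl
    rw [pow_zero, one_mul] at hgb
    have h1 := (h _ ((Ideal.span_singleton_prime hf.ne_zero).2 hf)).1
      (Ideal.mem_span_singleton_self f)
    rw [hgb, Ideal.mem_span_singleton] at h1
    exact hb h1
  -- A prime factor `q` of `b` generates a prime ideal containing `g`, hence `f`; so `q` is
  -- associated to `f`, although `f` does not divide `b`.
  · by_contra hu
    have hb0 : b ≠ 0 := by
      rintro rfl
      exact hb (dvd_zero f)
    obtain ⟨q, hq, hqb⟩ := WfDvdMonoid.exists_irreducible_factor hu hb0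
    have hqp := hq.prime
    have h1 := (h _ ((Ideal.span_singleton_prime hqp.ne_zero).2 hqp)).2
      (Ideal.mem_span_singleton.2 (hgb ▸ hqb.mul_left _))
    rw [Ideal.mem_span_singleton] at h1
    exact hb ((hq.dvd_symm hf.irreducible h1).trans hqb)

end Divisor

/-! ### The discriminant -/

section Discriminant

instance {m d : ℕ} : Nontrivial (DegreeExponent (m + 1) (d + 1)) :=
  (nearExponent_injective (n := m + 1) (d := d) 0).nontrivial

theorem zeroLocus_eq_compl_nonsingularLocus {k : Type u} [Field k] {n d : ℕ}
    {f : MvPolynomial (DegreeExponent n (d + 1)) k}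
    (hf : discriminantIdeal k n d = Ideal.span {f}) :
    ProjectiveSpectrum.zeroLocus (homogeneousSubmodule (DegreeExponent n (d + 1)) k) {f} =
      (nonsingularLocus k n (d + 1))ᶜ := by
  ext P
  have h := not_isNonsingularHypersurface_iff (R := k) (n := n) (d := d)
    (algebraMap (MvPolynomial (DegreeExponent n (d + 1)) k)
      P.asHomogeneousIdeal.toIdeal.ResidueField)
  rw [hf, Ideal.span_singleton_le_iff_mem, RingHom.mem_ker,
    Ideal.algebraMap_residueField_eq_zero] at h
  rw [ProjectiveSpectrum.mem_zeroLocus, Set.singleton_subset_iff]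
  exact h.symm

theorem aeval_eq_zero_iff_of_discriminantIdeal_eq {n d : ℕ}
    {Δ : MvPolynomial (DegreeExponent n (d + 1)) ℤ}
    (hΔ : discriminantIdeal ℤ n d = Ideal.span {Δ}) {K : Type u} [Field K]
    (c : DegreeExponent n (d + 1) → K) :
    aeval c Δ = 0 ↔ ¬ IsNonsingularHypersurface (formOfCoeffs c) := by
  have h := not_isNonsingularHypersurface_iff (R := ℤ) (n := n) (d := d) (aeval c).toRingHom
  rw [hΔ, Ideal.span_singleton_le_iff_mem] at h
  have hc : (fun α => (aeval (R := ℤ) c).toRingHom (X α)) = c := by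
    ext1 α
    exact aeval_X c α
  rw [hc] at h
  exact h.symm

theorem aeval_int_ringHom {σ K : Type*} [CommRing K] (c : MvPolynomial σ ℤ →+* K)
    (g : MvPolynomial σ ℤ) : aeval (fun s => c (X s)) g = c g := by
  have : (aeval fun s => c (X s)).toRingHom = c :=
    ringHom_ext' (RingHom.ext_int _ _) fun s => by simp
  exact DFunLike.congr_fun this g

/-- The discriminant generates the discriminant ideal over the integers. -/
theorem discriminantIdeal_eq_of_isDiscriminant {m d : ℕ}
    {Δ₀ Δ : MvPolynomial (DegreeExponent (m + 1) (d + 1)) ℤ} (hΔ₀ : Prime Δ₀)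
    (hI : discriminantIdeal ℤ (m + 1) d = Ideal.span {Δ₀}) (hΔ : IsDiscriminant.{u} Δ) :
    discriminantIdeal ℤ (m + 1) d = Ideal.span {Δ} := by
  -- The discriminant is only tested on fields in universe `u`; lifting `ℤ` puts the field of the
  -- generic singular form in characteristic zero there.
  let Z := ULift.{u} ℤ
  have : IsDomain Z := (ULift.ringEquiv (R := ℤ)).toMulEquiv.isDomain ℤ
  let B := MvPolynomial (ChartIndex (m + 1) d (0 : Fin (m + 1 + 1))) Z
  let K := AlgebraicClosure (FractionRing B)
  let j : ℤ →+* Z := (ULift.ringEquiv (R := ℤ)).symm.toRingHom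
  let ι : B →+* K := (algebraMap (FractionRing B) K).comp (algebraMap B (FractionRing B))
  have hι : Function.Injective ι :=
    (algebraMap (FractionRing B) K).injective.comp (IsFractionRing.injective B (FractionRing B))
  have hK : CharZero K := by
    refine charZero_of_injective_ringHom (f := (ι.comp (C : Z →+* B)).comp j) ?_
    exact (hι.comp (C_injective _ _)).comp (RingEquiv.injective _)
  let c : MvPolynomial (DegreeExponent (m + 1) (d + 1)) ℤ →+* K :=
    (ι.comp (incidenceHom Z d (0 : Fin (m + 1 + 1))).toRingHom).comp (map j)
  have hcker : ∀ g, c g = 0 → g ∈ discriminantIdeal ℤ (m + 1) d := by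
    intro g hg
    have h1 : map j g ∈ discriminantIdeal Z (m + 1) d :=
      hι (hg.trans (map_zero ι).symm)
    have h2 := map_mem_discriminantIdeal (ULift.ringEquiv (R := ℤ)).toRingHom h1
    rw [map_map] at h2
    convert h2 using 1
    rw [RingHom.ext_int ((ULift.ringEquiv (R := ℤ)).toRingHom.comp j) (RingHom.id ℤ), map_id]
  have hker : discriminantIdeal ℤ (m + 1) d ≤ RingHom.ker c := by
    intro g hg
    have h1 := map_mem_discriminantIdeal j hg
    change ι (incidenceHom Z d (0 : Fin (m + 1 + 1)) (map j g)) = 0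
    rw [show incidenceHom Z d (0 : Fin (m + 1 + 1)) (map j g) = 0 from h1, map_zero]
  have hsing := (not_isNonsingularHypersurface_iff c).2 hker
  have hc0 : (fun α => c (X α)) ≠ 0 := by
    intro h0
    obtain ⟨α, hα⟩ := exists_X_notMem_span_singleton hΔ₀
    exact hα (hI ▸ hcker _ (congrFun h0 α))
  have h3 := (hΔ.aeval_eq_zero_iff K _ hc0).2 hsing
  have h4 : c Δ = 0 := by
    rwa [aeval_int_ringHom] at h3
  have h5 := hcker Δ h4
  rw [hI, Ideal.mem_span_singleton] at h5
  rw [hI, Ideal.span_singleton_eq_span_singleton]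
  exact hΔ₀.irreducible.associated_of_dvd hΔ.irreducible h5

/-- A defining equation of the singular locus generates the discriminant ideal. -/
theorem discriminantIdeal_eq_of_isDefiningEquation {k : Type u} [Field k] {m d : ℕ}
    {f₀ f : MvPolynomial (DegreeExponent (m + 1) (d + 1)) k} (hf₀ : Prime f₀)
    (hom : ∃ N, f₀.IsHomogeneous N) (hI : discriminantIdeal k (m + 1) d = Ideal.span {f₀})
    (hf : IsDefiningEquation f (nonsingularLocus k (m + 1) (d + 1))ᶜ) :
    discriminantIdeal k (m + 1) d = Ideal.span {f} := by
  have hprime : (Ideal.span {f₀}).IsPrime := (Ideal.span_singleton_prime hf₀.ne_zero).2 hf₀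
  obtain ⟨s, hs⟩ := exists_X_notMem_span_singleton hf₀
  have h1 := (zeroLocus_eq_compl_nonsingularLocus hI).trans hf.zeroLocus_eq.symm
  -- The generic point of `V(f₀)` lies in the zero locus of `f`, which is precisely `f₀ ∣ f`;
  -- irreducibility makes them associated.
  have h2 : ProjectiveSpectrum.ofIdeal _ (isHomogeneous_span_singleton hom) hs ∈
      ProjectiveSpectrum.zeroLocus (homogeneousSubmodule _ k) {f₀} := fun g hg => by
    rw [Set.mem_singleton_iff.1 hg]
    exact Ideal.mem_span_singleton_self f₀
  rw [h1] at h2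
  have h3 : f ∈ Ideal.span {f₀} := h2 rfl
  rw [Ideal.mem_span_singleton] at h3
  rw [hI, Ideal.span_singleton_eq_span_singleton]
  exact hf₀.irreducible.associated_of_dvd hf.irreducible h3

/-- The reduction of a generator of the discriminant ideal over the integers is, up to a constant,
a power of a generator of the discriminant ideal over a field. -/
theorem exists_map_eq_C_mul_pow {k : Type u} [Field k] {n d : ℕ}
    {f : MvPolynomial (DegreeExponent n (d + 1)) k} {Δ : MvPolynomial (DegreeExponent n (d + 1)) ℤ}
    (hfp : Prime f) (hf : discriminantIdeal k n d = Ideal.span {f})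
    (hΔ : discriminantIdeal ℤ n d = Ideal.span {Δ}) :
    ∃ (e : ℕ) (c : k), 1 ≤ e ∧ c ≠ 0 ∧ map (Int.castRingHom k) Δ = C c * f ^ e := by
  obtain ⟨e, b, he, hb, h⟩ := exists_eq_mul_pow_of_forall_mem_iff hfp
    (g := map (Int.castRingHom k) Δ) fun P hP => by
      let q := algebraMap (MvPolynomial (DegreeExponent n (d + 1)) k) P.ResidueField
      have h1 := not_isNonsingularHypersurface_iff q
      have h2 := not_isNonsingularHypersurface_iff (q.comp (map (Int.castRingHom k)))
      simp only [RingHom.comp_apply, map_X] at h2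
      rw [hf, Ideal.span_singleton_le_iff_mem, RingHom.mem_ker,
        Ideal.algebraMap_residueField_eq_zero] at h1
      rw [hΔ, Ideal.span_singleton_le_iff_mem, RingHom.mem_ker, RingHom.comp_apply,
        Ideal.algebraMap_residueField_eq_zero] at h2
      exact h1.symm.trans h2
  obtain ⟨c, hc, rfl⟩ := MvPolynomial.isUnit_iff_eq_C_of_isReduced.1 hb
  exact ⟨e, c, he, hc.ne_zero, h⟩

end Discriminant

theorem theorem3p3 {k : Type u} [Field k] [IsAlgClosed k] (p : ℕ) [CharP k p] (n d : ℕ)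
    (hn : 1 ≤ n) (hd : 1 ≤ d) (hpd : p ∣ d) :
    IsIrreducibleDivisor (nonsingularLocus k n d)ᶜ ∧
    (∃ f : MvPolynomial (DegreeExponent n d) k,
      IsDefiningEquation f (nonsingularLocus k n d)ᶜ) ∧
    (∃ Δ : MvPolynomial (DegreeExponent n d) ℤ, IsDiscriminant.{u} Δ) ∧
    ∀ (f : MvPolynomial (DegreeExponent n d) k) (Δ : MvPolynomial (DegreeExponent n d) ℤ),
      IsDefiningEquation f (nonsingularLocus k n d)ᶜ → IsDiscriminant.{u} Δ →
        ∃ (e : ℕ) (c : k), 1 ≤ e ∧ c ≠ 0 ∧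
          MvPolynomial.map (Int.castRingHom k) Δ = MvPolynomial.C c * f ^ e := by
  have hp : p.Prime := by
    refine (CharP.char_is_prime_or_zero k p).resolve_right ?_
    rintro rfl
    have := Nat.eq_zero_of_zero_dvd hpd
    omega
  have : Fact p.Prime := ⟨hp⟩
  have hd2 : 2 ≤ d := hp.two_le.trans (Nat.le_of_dvd hd hpd)
  have hdk : (d : k) = 0 := (CharP.cast_eq_zero_iff k p d).2 hpd
  obtain ⟨m, rfl⟩ : ∃ m, n = m + 1 := ⟨n - 1, by omega⟩
  -- From here the degree is `d + 1`; as `p` divides it, it is at least `2`, which gives the `1 ≤ d`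
  -- needed for the cone.
  obtain ⟨d, rfl⟩ : ∃ d', d = d' + 1 := ⟨d - 1, by omega⟩
  have hd1 : 1 ≤ d := by omega
  obtain ⟨f₀, hf₀, hI⟩ := exists_prime_discriminantIdeal_eq (m := m) hd1 hdk
  obtain ⟨Δ₀, hΔ₀, hIZ⟩ := exists_prime_discriminantIdeal_int_eq (k := k) (m := m) p hd1 hdk
  have hom : ∃ N, f₀.IsHomogeneous N :=
    MvPolynomial.exists_isHomogeneous_of_homogeneousComponent_mem fun N => by
      rw [← hI]
      exact homogeneousComponent_mem_discriminantIdeal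
        (hI ▸ Ideal.mem_span_singleton_self f₀) N
  have hZ := zeroLocus_eq_compl_nonsingularLocus hI
  refine ⟨hZ ▸ isIrreducibleDivisor_zeroLocus hf₀ hom, ⟨f₀, hf₀.irreducible, hom, hZ⟩,
    ⟨Δ₀, hΔ₀.irreducible, fun K _ _ _ c _ => aeval_eq_zero_iff_of_discriminantIdeal_eq hIZ c⟩,
    fun f Δ hf hΔ => ?_⟩
  exact exists_map_eq_C_mul_pow hf.irreducible.prime
    (discriminantIdeal_eq_of_isDefiningEquation hf₀ hom hI hf)
    (discriminantIdeal_eq_of_isDiscriminant hΔ₀ hIZ hΔ)
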